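/- Let $a,b$ be nonzero coprime integers and $0<\varepsilon<1$. Write $S^3=\partial(D^2\times D^2)=\{(z,w)\in\mathbb C^2:\max(|z|,|w|)=1\}$, the union of the solid tori $T=\{|z|\le 1,\ |w|=1\}$ and $T^*=\{|z|=1,\ |w|\le 1\}$, and let $k=\{|z|=|w|=1,\ z^a=w^b\}$ be the torus knot of type $(a,b)$ on $T\cap T^*$. *Sectors.* For fixed $w$ with $|w|=1$, the radii on which $z^aw^{-b}$ is a nonpositive real number cut the meridian disc $\{|z|\le 1\}$ of $T$ into $|a|$ sectors, each with exactly one point of $k$ in the middle of its arc. Identify each sector with the half-disc $H=\{c\in\mathbb C:|c|\le 1,\ \operatorname{Re}c\ge 0\}$ through the coordinate $c$ with $|c|=|z|$ and $\arg c=\tfrac12\arg(z^aw^{-b})\in[-\tfrac\pi2,\tfrac\pi2]$ (where the argument is taken to be $\pi$ on one and $-\pi$ on the other of the two bounding radii, and $c=0$ at $z=0$); the knot point becomes $c=1$ and the bounding radii become the diameter $\operatorname{Re}c=0$. The meridian discs of $T^*$ are treated in the same way, with $(z,a)$ and $(w,b)$ interchanged. *Knot complement and spine.* Let $N^\circ(k)$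 be the open tubular neighbourhood of $k$ given by $|c-1|<\varepsilon$ in every sector, let $M^3=S^3\setminus N^\circ(k)$, and let the spine $B=\Sigma\cup\Sigma^*\subset M^3$ consist of the annulus $\{|z|=|w|=1\}\cap M^3$ and of all the radii bounding the sectors in the meridian discs of $T$ and of $T^*$. *Collapse.* Let $\rho:M^3\to B$ be the map which preserves every sector of every meridian disc and sends the point with coordinate $c$ to the point at which the ray from $1$ through $c$ leaves $H$ (through the diameter $\operatorname{Re}c=0$ or through the arc $|c|=1$). Let $X=\partial(M^3\times D^2)=\partial M^3\times D^2\cup M^3\times\partial D^2$, let $\pi:M^3\times D^2\to M^3$ be the projection, and let $p=\rho\circ(\pi|_X):X\to B$. Then $p$ is a $UV^1$-map, that is: $p$ is continuous, and for every $\delta>0$, every CW complex $K$ of dimension at most $2$, every subcomplex $K_0\subset K$ and all continuous maps $\alpha_0:K_0\to X$, $\alpha:K\to B$ with $p\circ\alpha_0=\alpha|_{K_0}$, there is a continuous map $\overline\alpha:K\to X$ with $\overline\alpha|_{K_0}=\alpha_0$ and $d(p(\overline\alpha(u)),\alpha(u))<\delta$ for all $u\in K$, where $d$ is the metric on $B$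 induced from $\mathbb C^2$ with the maximum norm. -/

import Mathlib

universe u

noncomputable section

namespace TorusKnotSpine

/-! ### `UV¹` maps -/

/-- `p : X → B` is a `UV¹(δ)`-map: for every CW pair `(K, K₀)` with `K` of dimension at most `2`,
and all maps `α₀ : K₀ → X`, `α : K → B` with `p ∘ α₀ = α|K₀`, there is a map `αbar : K → X` with
`αbar|K₀ = α₀` and `d(p (αbar x), α x) < δ` for all `x ∈ K`. -/
def IsUVOneDelta {X B : Type*} [TopologicalSpace X] [MetricSpace B] (p : X → B) (δ : ℝ) : Prop :=
  ∀ (K : Type u) [TopologicalSpace K] [T2Space K] [Topology.CWComplex (Set.univ : Set K)],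
    (∀ n : ℕ, 2 < n → IsEmpty (Topology.RelCWComplex.cell (Set.univ : Set K) n)) →
    ∀ (K₀ : Topology.RelCWComplex.Subcomplex (Set.univ : Set K))
      (α₀ : C(↥(K₀ : Set K), X)) (α : C(K, B)),
      (∀ x : ↥(K₀ : Set K), p (α₀ x) = α x) →
      ∃ αbar : C(K, X), (∀ x : ↥(K₀ : Set K), αbar x = α₀ x) ∧ ∀ x : K, dist (p (αbar x)) (α x) < δ

/-- A `UV¹`-map is a continuous map which is a `UV¹(δ)`-map for every `δ > 0`. -/
def IsUVOneMap {X B : Type*} [TopologicalSpace X] [MetricSpace B] (p : X → B) : Prop :=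
  Continuous p ∧ ∀ δ : ℝ, 0 < δ → IsUVOneDelta.{u} p δ

/-! ### The `3`-sphere, the solid tori and their meridian discs -/

/-- The `3`-sphere as the boundary of the bidisc: `max (|z|, |w|) = 1` in `ℂ × ℂ` (the norm of
`ℂ × ℂ` is the maximum norm). It is the union of the solid tori `T = {|z| ≤ 1, |w| = 1}` and
`T* = {|z| = 1, |w| ≤ 1}`, which meet in the torus `|z| = |w| = 1`. -/
abbrev S3 : Type := ↥(Metric.sphere (0 : ℂ × ℂ) 1)

/-- The torus knot of type `(a, b)` on the common boundary torus: `|z| = |w| = 1`, `z ^ a = w ^ b`.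
It meets each meridian disc of `T` in `|a|` points and each meridian disc of `T*` in `|b|` points. -/
def torusKnot (a b : ℤ) : Set S3 :=
  {x | ‖x.1.1‖ = 1 ∧ ‖x.1.2‖ = 1 ∧ x.1.1 ^ a = x.1.2 ^ b}

/-- In the meridian disc `{(u, v) : |u| ≤ 1}` over a point `v` of the unit circle, the points `ζ`
with `|ζ| = 1` and `ζ ^ m = v ^ n` are the centres of `|m|` sectors, bounded by the `|m|` radii
on which `u ^ m * v ^ (-n)` is a nonpositive real. Each sector is identified with the
half-disc `{c : |c| ≤ 1, 0 ≤ Re c}`, so that `ζ` becomes `1` and the two bounding radii become the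
diameter `Re c = 0`. This is the half-disc coordinate of `u`: its modulus is `|u|`, and its
argument is half the argument of `u ^ m * v ^ (-n)`. -/
def sectorCoord (m n : ℤ) (u v : ℂ) : ℂ :=
  (‖u‖ : ℂ) * Complex.exp (((u ^ m * v ^ (-n)).arg / 2 : ℝ) * Complex.I)

/-- Projection of the half-disc `{c : |c| ≤ 1, 0 ≤ Re c}` minus the point `1` from the point `1` to
the rest of the boundary: the ray from `1` through `c` leaves the half-disc either through the
diameter `Re c = 0`, at height `Im c / (1 - Re c)`, or through the circle `|c| = 1`. -/
def halfDiscProj (c : ℂ) : ℂ :=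
  if |c.im| ≤ 1 - c.re then ((c.im / (1 - c.re) : ℝ) : ℂ) * Complex.I
  else -(c - 1) / (starRingEnd ℂ) (c - 1)

/-- The collapse of a meridian disc: `halfDiscProj` in the half-disc coordinate of each sector. If
`u` has half-disc coordinate `c` and `c' = halfDiscProj c`, the image of `u` is the point of the
same sector with half-disc coordinate `c'`. -/
def discCollapse (m n : ℤ) (u v : ℂ) : ℂ :=
  let c := sectorCoord m n u v
  let c' := halfDiscProj c
  u / (‖u‖ : ℂ) * ((‖c'‖ : ℂ) * Complex.exp ((2 * (c'.arg - c.arg) / m : ℝ) * Complex.I))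

/-- The half-disc coordinate on the whole sphere; the two solid tori have their own meridian discs.
On the common torus the coordinates from the two sides are complex conjugate to each other. -/
def coord (a b : ℤ) (x : S3) : ℂ :=
  if ‖x.1.2‖ = 1 then sectorCoord a b x.1.1 x.1.2 else sectorCoord b a x.1.2 x.1.1

/-! ### The knot complement, its spine and the collapse -/

/-- The open tubular neighbourhood of the torus knot: in each sector of each meridian disc, the
points whose half-disc coordinate has distance less than `ε` from the knot point `1`. -/
def tube (a b : ℤ) (ε : ℝ) : Set S3 :=
  {x | ‖coord a b x - 1‖ < ε}

/-- The knot complement `M = S³ \ N°(k)`. -/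
def knotComplement (a b : ℤ) (ε : ℝ) : Set S3 :=
  (tube a b ε)ᶜ

/-- The spine `B = Σ ∪ Σ*` of the knot complement: the annulus which the torus `|z| = |w| = 1` has
in common with the knot complement, together with, in every meridian disc of `T` and of `T*`, the
radii that bound the sectors, that is, the points where `z ^ a * w ^ (-b)` is a nonpositive real
(which includes the two core circles `z = 0` and `w = 0`). -/
def spine (a b : ℤ) (ε : ℝ) : Set S3 :=
  {x | x ∈ knotComplement a b ε ∧
    ((‖x.1.1‖ = 1 ∧ ‖x.1.2‖ = 1) ∨
      ((x.1.1 ^ a * x.1.2 ^ (-b)).re ≤ 0 ∧ (x.1.1 ^ a * x.1.2 ^ (-b)).im = 0))}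

/-- The collapse `ρ`, in the coordinates of `ℂ × ℂ`: every meridian disc of `T` and of `T*` is
collapsed in itself. -/
def collapseFun (a b : ℤ) (x : S3) : ℂ × ℂ :=
  if ‖x.1.2‖ = 1 then (discCollapse a b x.1.1 x.1.2, x.1.2)
  else (x.1.1, discCollapse b a x.1.2 x.1.1)

/-- `X = ∂(M × D²) = ∂M × D² ∪ M × ∂D²`, as a subset of `S³ × ℝ²`, with `ℂ` for `ℝ²`. -/
def bdry (a b : ℤ) (ε : ℝ) : Set (S3 × ℂ) :=
  {q | q.1 ∈ knotComplement a b ε ∧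
    ((q.1 ∈ frontier (knotComplement a b ε) ∧ ‖q.2‖ ≤ 1) ∨ ‖q.2‖ = 1)}

/-! ### The collapse maps the knot complement into the spine -/

theorem norm_sectorCoord (m n : ℤ) (u v : ℂ) : ‖sectorCoord m n u v‖ = ‖u‖ := by
  rw [sectorCoord, norm_mul, Complex.norm_exp_ofReal_mul_I, Complex.norm_real, norm_norm, mul_one]

theorem re_sectorCoord (m n : ℤ) (u v : ℂ) :
    (sectorCoord m n u v).re = ‖u‖ * Real.cos ((u ^ m * v ^ (-n)).arg / 2) := by
  rw [sectorCoord, Complex.re_ofReal_mul, Complex.exp_ofReal_mul_I_re]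

theorem re_sectorCoord_nonneg (m n : ℤ) (u v : ℂ) : 0 ≤ (sectorCoord m n u v).re := by
  rw [re_sectorCoord]
  have h1 := Complex.neg_pi_lt_arg (u ^ m * v ^ (-n))
  have h2 := Complex.arg_le_pi (u ^ m * v ^ (-n))
  exact mul_nonneg (norm_nonneg _)
    (Real.cos_nonneg_of_neg_pi_div_two_le_of_le (by linarith) (by linarith))

theorem arg_sectorCoord (m n : ℤ) {u : ℂ} (v : ℂ) (hu : u ≠ 0) :
    (sectorCoord m n u v).arg = (u ^ m * v ^ (-n)).arg / 2 := by
  have h1 := Complex.neg_pi_lt_arg (u ^ m * v ^ (-n))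
  have h2 := Complex.arg_le_pi (u ^ m * v ^ (-n))
  rw [sectorCoord, Complex.exp_mul_I]
  exact Complex.arg_mul_cos_add_sin_mul_I (norm_pos_iff.2 hu)
    ⟨by linarith [Real.pi_pos], by linarith [Real.pi_pos]⟩

theorem halfDiscProj_spec {c : ℂ} (h0 : 0 ≤ c.re) (h1 : ‖c‖ ≤ 1) (hc : c ≠ 1) :
    ((halfDiscProj c).re = 0 ∧ ‖halfDiscProj c‖ ≤ 1) ∨
      (‖halfDiscProj c‖ = 1 ∧ 0 < (halfDiscProj c).re ∧ ‖c - 1‖ ≤ ‖halfDiscProj c - 1‖ ∧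
        c ≠ 0) := by
  have hsq : c.re * c.re + c.im * c.im ≤ 1 := by
    have := Complex.normSq_eq_norm_sq c
    rw [Complex.normSq_apply] at this
    rw [this]; nlinarith [norm_nonneg c]
  have hre : c.re < 1 := by
    rcases lt_or_ge c.re 1 with h | h
    · exact h
    · exfalso; apply hc
      have hr : c.re = 1 := by nlinarith [mul_self_nonneg c.im]
      have hi : c.im = 0 := by
        rw [hr] at hsq; nlinarith [mul_self_nonneg c.im]
      exact Complex.ext hr hi
  by_cases h : |c.im| ≤ 1 - c.re
  · left
    rw [halfDiscProj, if_pos h]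
    refine ⟨by rw [Complex.re_ofReal_mul, Complex.I_re, mul_zero], ?_⟩
    rw [norm_mul, Complex.norm_I, mul_one, Complex.norm_real, Real.norm_eq_abs, abs_div,
      abs_of_pos (sub_pos.2 hre)]
    exact (div_le_one (sub_pos.2 hre)).2 h
  · right
    rw [halfDiscProj, if_neg h]
    have hne : c - 1 ≠ 0 := sub_ne_zero.2 hc
    have hne' : (starRingEnd ℂ) (c - 1) ≠ 0 := (map_ne_zero _).2 hne
    have hpos : 0 < ‖c - 1‖ := norm_pos_iff.2 hne
    have hnsq : ‖c - 1‖ ^ 2 = (c.re - 1) * (c.re - 1) + c.im * c.im := by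
      rw [← Complex.normSq_eq_norm_sq, Complex.normSq_apply]; simp
    push Not at h
    have hlt : (1 - c.re) * (1 - c.re) < c.im * c.im := by
      rw [← abs_mul_abs_self c.im]
      nlinarith
    refine ⟨?_, ?_, ?_, ?_⟩
    · rw [norm_div, norm_neg, Complex.norm_conj, div_self hpos.ne']
    · rw [Complex.div_re]
      simp only [Complex.neg_re, Complex.neg_im, Complex.conj_re, Complex.conj_im,
        Complex.sub_re, Complex.sub_im, Complex.one_re, Complex.one_im, sub_zero,
        Complex.normSq_conj]
      rw [← add_div]
      apply div_pos
      · nlinarith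
      · exact Complex.normSq_pos.2 hne
    · have : -(c - 1) / (starRingEnd ℂ) (c - 1) - 1
          = ((2 * (1 - c.re) : ℝ) : ℂ) / (starRingEnd ℂ) (c - 1) := by
        rw [div_sub_one hne']
        congr 1
        refine Complex.ext ?_ ?_
        · simp; ring
        · simp
      rw [this, norm_div, Complex.norm_conj, Complex.norm_real, Real.norm_eq_abs,
        abs_of_pos (by linarith), le_div_iff₀ hpos]
      nlinarith
    · rintro rfl
      simp at hlt
      linarith

theorem norm_discCollapse (m n : ℤ) {u : ℂ} (v : ℂ) (hu : u ≠ 0) :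
    ‖discCollapse m n u v‖ = ‖halfDiscProj (sectorCoord m n u v)‖ := by
  have : ‖u‖ ≠ 0 := norm_ne_zero_iff.2 hu
  simp only [discCollapse, norm_mul, norm_div, Complex.norm_real, norm_norm,
    Complex.norm_exp_ofReal_mul_I, div_self this, one_mul, mul_one]

theorem discCollapse_zero (m n : ℤ) (v : ℂ) : discCollapse m n 0 v = 0 := by
  simp [discCollapse]

/-- The half-disc coordinate of the collapsed point is `halfDiscProj c`, up to the identification of
the points `c` and `-c` of the diameter by the choice of the sector. -/
theorem discCollapse_zpow {m : ℤ} (n : ℤ) (hm : m ≠ 0) {u v : ℂ} (hu : u ≠ 0) (hv : ‖v‖ = 1) :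
    discCollapse m n u v ^ m * v ^ (-n) =
      ((‖halfDiscProj (sectorCoord m n u v)‖ ^ m : ℝ) : ℂ) *
        Complex.exp ((2 * (halfDiscProj (sectorCoord m n u v)).arg : ℝ) * Complex.I) := by
  have hnu : ‖u‖ ≠ 0 := norm_ne_zero_iff.2 hu
  have hnu' : (‖u‖ : ℂ) ≠ 0 := Complex.ofReal_ne_zero.2 hnu
  have hmC : (m : ℂ) ≠ 0 := Int.cast_ne_zero.2 hm
  have hmR : (m : ℝ) ≠ 0 := Int.cast_ne_zero.2 hm
  have hs := Complex.norm_mul_exp_arg_mul_I (u ^ m * v ^ (-n))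
  have hns : ‖u ^ m * v ^ (-n)‖ = ‖u‖ ^ m := by simp [norm_zpow, hv]
  rw [hns] at hs
  simp only [discCollapse]
  rw [arg_sectorCoord m n v hu]
  set τ := (u ^ m * v ^ (-n)).arg with hτ
  set c' := halfDiscProj (sectorCoord m n u v) with hc'
  rw [mul_zpow, mul_zpow, div_zpow, ← Complex.exp_int_mul]
  have e1 : (m : ℂ) * (((2 * (c'.arg - τ / 2) / m : ℝ) : ℂ) * Complex.I)
      = ((2 * c'.arg : ℝ) : ℂ) * Complex.I - (τ : ℂ) * Complex.I := by
    push_cast; field_simp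
  rw [e1, Complex.exp_sub]
  have hexp := Complex.exp_ne_zero ((τ : ℂ) * Complex.I)
  have hz : (‖u‖ : ℂ) ^ m ≠ 0 := zpow_ne_zero _ hnu'
  have hs' : u ^ m * v ^ (-n) = (‖u‖ : ℂ) ^ m * Complex.exp ((τ : ℂ) * Complex.I) := by
    rw [← hs]; push_cast; rfl
  calc _ = (u ^ m * v ^ (-n)) / ((‖u‖ : ℂ) ^ m * Complex.exp ((τ : ℂ) * Complex.I)) *
        ((‖c'‖ : ℂ) ^ m * Complex.exp (((2 * c'.arg : ℝ) : ℂ) * Complex.I)) := by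
        field_simp
    _ = _ := by
        rw [hs', div_self (mul_ne_zero hz hexp), one_mul]; push_cast; rfl

/-- A point whose half-disc coordinate lies on the diameter is at distance at least `1` from `1`. -/
theorem one_le_norm_sub_one {c : ℂ} (h : c.re = 0) : 1 ≤ ‖c - 1‖ := by
  have := Complex.abs_re_le_norm (c - 1)
  simpa [h] using this

theorem re_sectorCoord_eq_zero {m n : ℤ} {u v : ℂ} (hv : v ≠ 0)
    (h1 : (u ^ m * v ^ (-n)).re ≤ 0) (h2 : (u ^ m * v ^ (-n)).im = 0) :
    (sectorCoord m n u v).re = 0 := by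
  rw [re_sectorCoord]
  by_cases hu : u = 0
  · simp [hu]
  · have hne : u ^ m * v ^ (-n) ≠ 0 := mul_ne_zero (zpow_ne_zero _ hu) (zpow_ne_zero _ hv)
    have hlt : (u ^ m * v ^ (-n)).re < 0 :=
      lt_of_le_of_ne h1 fun h => hne (Complex.ext h h2)
    rw [Complex.arg_eq_pi_iff.2 ⟨hlt, h2⟩, Real.cos_pi_div_two, mul_zero]

theorem discCollapse_spec {m : ℤ} (n : ℤ) (hm : m ≠ 0) {u v : ℂ} (hu1 : ‖u‖ ≤ 1) (hv : ‖v‖ = 1)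
    (hc : sectorCoord m n u v ≠ 1) :
    ‖discCollapse m n u v‖ ≤ 1 ∧
      (((discCollapse m n u v ^ m * v ^ (-n)).re ≤ 0 ∧
          (discCollapse m n u v ^ m * v ^ (-n)).im = 0) ∨
        (‖discCollapse m n u v‖ = 1 ∧
          sectorCoord m n (discCollapse m n u v) v = halfDiscProj (sectorCoord m n u v) ∧
          ‖sectorCoord m n u v - 1‖ ≤ ‖sectorCoord m n (discCollapse m n u v) v - 1‖)) := by
  by_cases hu : u = 0
  · subst hu
    simp [discCollapse_zero, zero_zpow m hm]
  have hz := discCollapse_zpow (m := m) n hm hu hv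
  have hn := norm_discCollapse m n v hu
  rcases halfDiscProj_spec (re_sectorCoord_nonneg m n u v)
    ((norm_sectorCoord m n u v).trans_le hu1) hc with ⟨h0, h1⟩ | ⟨h1, h2, h3, h4⟩
  · refine ⟨hn.trans_le h1, Or.inl ?_⟩
    rw [hz]
    set c' := halfDiscProj (sectorCoord m n u v) with hc'
    rw [Complex.re_ofReal_mul, Complex.im_ofReal_mul, Complex.exp_ofReal_mul_I_re,
      Complex.exp_ofReal_mul_I_im]
    by_cases hc0 : c' = 0
    · simp [hc0, zero_zpow m hm]
    · have hcos : Real.cos c'.arg = 0 := by rw [Complex.cos_arg hc0, h0, zero_div]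
      rw [Real.cos_two_mul, Real.sin_two_mul, hcos]
      have : 0 ≤ ‖c'‖ ^ m := zpow_nonneg (norm_nonneg _) m
      constructor
      · nlinarith
      · ring
  · refine ⟨(hn.trans h1).le, Or.inr ⟨hn.trans h1, ?_⟩⟩
    have key : sectorCoord m n (discCollapse m n u v) v = halfDiscProj (sectorCoord m n u v) := by
      rw [sectorCoord, hn, hz]
      set c' := halfDiscProj (sectorCoord m n u v) with hc'
      rw [h1, one_zpow, Complex.ofReal_one, one_mul, one_mul]
      have ha := abs_lt.1 (Complex.abs_arg_lt_pi_div_two_iff.2 (Or.inl h2))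
      have e : (Complex.exp ((2 * c'.arg : ℝ) * Complex.I)).arg = 2 * c'.arg := by
        rw [Complex.exp_mul_I]
        exact Complex.arg_cos_add_sin_mul_I ⟨by linarith, by linarith⟩
      rw [e, mul_div_cancel_left₀ _ two_ne_zero]
      have := Complex.norm_mul_exp_arg_mul_I c'
      rwa [h1, Complex.ofReal_one, one_mul] at this
    exact ⟨key, by rw [key]; exact h3⟩

theorem norm_sectorCoord_sub_one_symm {m n : ℤ} {u v : ℂ} (hu : ‖u‖ = 1) (hv : ‖v‖ = 1) :
    ‖sectorCoord m n u v - 1‖ = ‖sectorCoord n m v u - 1‖ := by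
  have h : ∀ (m n : ℤ) (u v : ℂ), ‖u‖ = 1 →
      ‖sectorCoord m n u v - 1‖ ^ 2 = 2 - 2 * Real.cos ((u ^ m * v ^ (-n)).arg / 2) := by
    intro m n u v hu
    have h1 := Complex.normSq_eq_norm_sq (sectorCoord m n u v)
    have h2 := re_sectorCoord m n u v
    rw [norm_sectorCoord, hu, Complex.normSq_apply] at h1
    rw [hu, one_mul] at h2
    rw [← Complex.normSq_eq_norm_sq, Complex.normSq_apply, ← h2]
    simp only [Complex.sub_re, Complex.sub_im, Complex.one_re, Complex.one_im]
    nlinarith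
  have hinv : v ^ n * u ^ (-m) = (u ^ m * v ^ (-n))⁻¹ := by
    rw [zpow_neg, zpow_neg, mul_inv, inv_inv, mul_comm]
  have hcos : Real.cos ((v ^ n * u ^ (-m)).arg / 2) = Real.cos ((u ^ m * v ^ (-n)).arg / 2) := by
    rw [hinv, Complex.arg_inv]
    split_ifs with hpi
    · rw [hpi]
    · rw [neg_div, Real.cos_neg]
  have := (h m n u v hu).trans ((h n m v u hv).trans (by rw [hcos])).symm
  exact (sq_eq_sq₀ (norm_nonneg _) (norm_nonneg _)).1 this

theorem mem_S3 {z w : ℂ} : (z, w) ∈ Metric.sphere (0 : ℂ × ℂ) 1 ↔ max ‖z‖ ‖w‖ = 1 := by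
  rw [mem_sphere_zero_iff_norm, Prod.norm_def]

theorem norm_of_S3 (x : S3) : ‖x.1.1‖ ≤ 1 ∧ ‖x.1.2‖ ≤ 1 ∧ (‖x.1.2‖ ≠ 1 → ‖x.1.1‖ = 1) := by
  have h : max ‖x.1.1‖ ‖x.1.2‖ = 1 := mem_S3.1 x.2
  refine ⟨(le_max_left _ _).trans h.le, (le_max_right _ _).trans h.le, fun h2 => ?_⟩
  rcases max_choice ‖x.1.1‖ ‖x.1.2‖ with h' | h'
  · rw [← h', h]
  · exact absurd (h'.symm.trans h) h2

theorem one_le_norm_coord_sub_one {a b : ℤ} (x : S3)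
    (h1 : (x.1.1 ^ a * x.1.2 ^ (-b)).re ≤ 0) (h2 : (x.1.1 ^ a * x.1.2 ^ (-b)).im = 0) :
    1 ≤ ‖coord a b x - 1‖ := by
  apply one_le_norm_sub_one
  rw [coord]
  split_ifs with h
  · exact re_sectorCoord_eq_zero (fun h0 => by simp [h0] at h) h1 h2
  · have hz := (norm_of_S3 x).2.2 h
    have hinv : x.1.2 ^ b * x.1.1 ^ (-a) = (x.1.1 ^ a * x.1.2 ^ (-b))⁻¹ := by
      rw [zpow_neg, zpow_neg, mul_inv, inv_inv, mul_comm]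
    refine re_sectorCoord_eq_zero (fun h0 => by simp [h0] at hz) ?_ ?_
    · rw [hinv, Complex.inv_re]
      exact div_nonpos_of_nonpos_of_nonneg h1 (Complex.normSq_nonneg _)
    · rw [hinv, Complex.inv_im, h2, neg_zero, zero_div]

theorem coord_ne_one {a b : ℤ} {ε : ℝ} (hε : 0 < ε) {x : S3} (hx : x ∈ knotComplement a b ε) :
    coord a b x ≠ 1 := by
  intro h
  apply hx
  simpa [tube, h] using hε

/-- The torus knot is the set where the half-disc coordinate is `1`. -/
theorem mem_torusKnot_iff {a b : ℤ} {x : S3} : x ∈ torusKnot a b ↔ coord a b x = 1 := by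
  have hx := norm_of_S3 x
  constructor
  · rintro ⟨hz, hw, h⟩
    have hw0 : x.1.2 ≠ 0 := fun h0 => by simp [h0] at hw
    rw [coord, if_pos hw, sectorCoord, h, ← zpow_add₀ hw0]
    simp [hz]
  · intro h
    by_cases hw : ‖x.1.2‖ = 1
    · rw [coord, if_pos hw] at h
      have hw0 : x.1.2 ≠ 0 := fun h0 => by simp [h0] at hw
      have hz : ‖x.1.1‖ = 1 := by rw [← norm_sectorCoord a b x.1.1 x.1.2, h, norm_one]
      have hz0 : x.1.1 ≠ 0 := fun h0 => by simp [h0] at hz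
      have harg := arg_sectorCoord a b x.1.2 hz0
      rw [h, Complex.arg_one] at harg
      have hs := Complex.norm_mul_exp_arg_mul_I (x.1.1 ^ a * x.1.2 ^ (-b))
      rw [show (x.1.1 ^ a * x.1.2 ^ (-b)).arg = 0 by linarith] at hs
      simp only [norm_mul, norm_zpow, hz, hw, one_zpow, Complex.ofReal_zero, zero_mul,
        Complex.exp_zero, mul_one, Complex.ofReal_one] at hs
      refine ⟨hz, hw, ?_⟩
      rw [zpow_neg, ← div_eq_mul_inv] at hs
      exact (div_eq_one_iff_eq (zpow_ne_zero _ hw0)).1 hs.symm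
    · rw [coord, if_neg hw] at h
      exact absurd (by rw [← norm_sectorCoord b a x.1.2 x.1.1, h, norm_one]) hw

theorem mem_knotComplement {a b : ℤ} {ε : ℝ} {x : S3} :
    x ∈ knotComplement a b ε ↔ ε ≤ ‖coord a b x - 1‖ := by
  simp only [knotComplement, tube, Set.mem_compl_iff, Set.mem_ofPred_eq, not_lt]

/-- The collapse maps the knot complement into the spine. -/
theorem collapseFun_mem {a b : ℤ} (ha : a ≠ 0) (hb : b ≠ 0) {ε : ℝ} (hε : 0 < ε) (hε1 : ε < 1)
    {x : S3} (hx : x ∈ knotComplement a b ε) :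
    ∃ h : collapseFun a b x ∈ Metric.sphere (0 : ℂ × ℂ) 1, (⟨_, h⟩ : S3) ∈ spine a b ε := by
  have hc := coord_ne_one hε hx
  have hxε : ε ≤ ‖coord a b x - 1‖ := not_lt.1 hx
  obtain ⟨hz, hw, hzw⟩ := norm_of_S3 x
  by_cases h : ‖x.1.2‖ = 1
  · have e : collapseFun a b x = (discCollapse a b x.1.1 x.1.2, x.1.2) := if_pos h
    have ec : coord a b x = sectorCoord a b x.1.1 x.1.2 := if_pos h
    rw [ec] at hc hxε
    obtain ⟨hn, hs⟩ := discCollapse_spec b ha hz h hc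
    rw [e]
    have hmem : (discCollapse a b x.1.1 x.1.2, x.1.2) ∈ Metric.sphere (0 : ℂ × ℂ) 1 :=
      mem_S3.2 (by rw [h]; exact max_eq_right hn)
    refine ⟨hmem, ?_⟩
    rcases hs with ⟨h1, h2⟩ | ⟨h1, -, h3⟩
    · exact ⟨mem_knotComplement.2 (hε1.le.trans (one_le_norm_coord_sub_one ⟨_, hmem⟩ h1 h2)),
        Or.inr ⟨h1, h2⟩⟩
    · refine ⟨mem_knotComplement.2 ?_, Or.inl ⟨h1, h⟩⟩
      have ec' : coord a b ⟨_, hmem⟩ = sectorCoord a b (discCollapse a b x.1.1 x.1.2) x.1.2 :=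
        if_pos h
      rw [ec']
      exact hxε.trans h3
  · have hz1 := hzw h
    have e : collapseFun a b x = (x.1.1, discCollapse b a x.1.2 x.1.1) := if_neg h
    have ec : coord a b x = sectorCoord b a x.1.2 x.1.1 := if_neg h
    rw [ec] at hc hxε
    obtain ⟨hn, hs⟩ := discCollapse_spec a hb hw hz1 hc
    rw [e]
    have hmem : (x.1.1, discCollapse b a x.1.2 x.1.1) ∈ Metric.sphere (0 : ℂ × ℂ) 1 :=
      mem_S3.2 (by rw [hz1]; exact max_eq_left hn)
    refine ⟨hmem, ?_⟩
    rcases hs with ⟨h1, h2⟩ | ⟨h1, -, h3⟩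
    · have hinv : x.1.1 ^ a * (discCollapse b a x.1.2 x.1.1) ^ (-b)
          = ((discCollapse b a x.1.2 x.1.1) ^ b * x.1.1 ^ (-a))⁻¹ := by
        rw [zpow_neg, zpow_neg, mul_inv, inv_inv, mul_comm]
      have h1' : (x.1.1 ^ a * (discCollapse b a x.1.2 x.1.1) ^ (-b)).re ≤ 0 := by
        rw [hinv, Complex.inv_re]
        exact div_nonpos_of_nonpos_of_nonneg h1 (Complex.normSq_nonneg _)
      have h2' : (x.1.1 ^ a * (discCollapse b a x.1.2 x.1.1) ^ (-b)).im = 0 := by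
        rw [hinv, Complex.inv_im, h2, neg_zero, zero_div]
      exact ⟨mem_knotComplement.2 (hε1.le.trans (one_le_norm_coord_sub_one ⟨_, hmem⟩ h1' h2')),
        Or.inr ⟨h1', h2'⟩⟩
    · refine ⟨mem_knotComplement.2 ?_, Or.inl ⟨hz1, h1⟩⟩
      have ec' : coord a b ⟨_, hmem⟩ = sectorCoord a b x.1.1 (discCollapse b a x.1.2 x.1.1) :=
        if_pos h1
      rw [ec', norm_sectorCoord_sub_one_symm hz1 h1]
      exact hxε.trans h3

/-! ### The map `p : X → B` -/

/-- The collapse `ρ : M → B`. -/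
def collapse {a b : ℤ} (ha : a ≠ 0) (hb : b ≠ 0) {ε : ℝ} (hε : 0 < ε) (hε1 : ε < 1)
    (x : ↥(knotComplement a b ε)) : ↥(spine a b ε) :=
  ⟨⟨collapseFun a b x, (collapseFun_mem ha hb hε hε1 x.2).1⟩,
    (collapseFun_mem ha hb hε hε1 x.2).2⟩

/-- The map `p = ρ ∘ π|X : X → B`, where `π : M × D² → M` is the projection. -/
def bdryCollapse {a b : ℤ} (ha : a ≠ 0) (hb : b ≠ 0) {ε : ℝ} (hε : 0 < ε) (hε1 : ε < 1)
    (q : ↥(bdry a b ε)) : ↥(spine a b ε) :=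
  collapse ha hb hε hε1 ⟨q.1.1, q.2.1⟩

end TorusKnotSpine

end

noncomputable section

namespace TorusKnotSpine

open Set Metric Topology

/-! ### Extending maps over the cells of a CW complex -/

section CW

open Topology.RelCWComplex

variable {K : Type u} [TopologicalSpace K] [T2Space K] [CWComplex (univ : Set K)]
  {Y : Type*} [TopologicalSpace Y]

/-! In every sector the collapse is the projection of the half-disc from the knot point, so sliding
along the rays from 1 deforms `M` onto `B` inside the fibres of `ρ`. Going back along the same rays,
every point of `B` is joined within its fibre to `∂M`. These two facts form a `FiberwiseCollapse`,
and they alone give the `UV¹` property (`isUVOneMap_proj`).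

A point of `X` is a pair `(x, ζ)` with `|ζ| = 1`, or with `x ∈ ∂M` and `|ζ| ≤ 1`. To extend a lift
from the boundary of a cell of dimension at most 2 (`exists_cell_lift`), first move `ζ` to a map `ω`
into the unit circle that agrees with `ζ` wherever `|ζ| = 1`; it exists because a set of dimension
less than 2 can be pushed off the centre of the disc (`exists_norm_eq_one`). With `ω` fixed, let `x`
flow to `B`, follow `α` inwards, and near the centre of the cell move along one fibre to `∂M`. There
the disc coordinate may leave the circle, so the loop `ω` is coned off. The result lies exactly over
`α ∘ F` for a reparametrization `F` close to the identity.

Over the 1-cells this leaves an approximate lift, which cannot be fed directly into the exact lemma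
for 2-cells. The extension therefore also records small paths from `α` to the projected lift;
inserted as a collar, they turn the approximate boundary data into an exact lift
(`exists_cell_lift_of_path`).

Continuity of the flow is not read off its formula, in which `arg` jumps. The knot complement is a
quotient of a compact family of truncated half-discs, on which the flow is a straight-line homotopy
(`continuous_complementFlow`). -/

theorem continuousOn_closedCell_iff {n : ℕ} (e : cell (univ : Set K) n) {f : K → Y} :
    ContinuousOn f (closedCell n e) ↔ ContinuousOn (f ∘ map n e) (closedBall 0 1) := by
  have hm := RelCWComplex.continuousOn (C := (univ : Set K)) n e
  constructor
  · intro h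
    exact h.comp hm (mapsTo_image _ _)
  · intro h
    rw [continuousOn_iff_isClosed] at h ⊢
    intro t ht
    obtain ⟨v, hv, hvt⟩ := h t ht
    -- The ball is compact and `K` is Hausdorff, so the characteristic map is closed on the ball.
    refine ⟨map n e '' (v ∩ closedBall 0 1), ?_, ?_⟩
    · exact (((isCompact_closedBall 0 1).inter_left hv).image_of_continuousOn
        (hm.mono inter_subset_right)).isClosed
    · rw [← hvt]
      ext x
      constructor
      · rintro ⟨hx, u, hu, rfl⟩
        exact ⟨⟨u, ⟨hx, hu⟩, rfl⟩, u, hu, rfl⟩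
      · rintro ⟨⟨u, ⟨hx, hu⟩, rfl⟩, h'⟩
        exact ⟨hx, h'⟩

theorem continuous_of_continuousOn_closedCell {f : K → Y}
    (h : ∀ n (e : cell (univ : Set K) n), ContinuousOn f (closedCell n e)) : Continuous f := by
  rw [continuous_iff_isClosed]
  intro s hs
  rw [CWComplex.closed (univ : Set K) _ (subset_univ _)]
  intro n e
  rw [inter_comm]
  exact (h n e).preimage_isClosed_of_isClosed isClosed_closedCell hs

/-- The attaching sphere meets only finitely many lower cells, so continuity glues over a finite
closed cover. -/
theorem continuousOn_comp_map_sphere {n : ℕ} {f : K → Y}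
    (h : ∀ m < n, ∀ e : cell (univ : Set K) m, ContinuousOn f (closedCell m e))
    (e : cell (univ : Set K) n) : ContinuousOn (f ∘ map n e) (sphere 0 1) := by
  obtain ⟨I, hI⟩ := CWComplex.mapsTo (C := (univ : Set K)) n e
  have hc : ContinuousOn f (⋃ m : Fin n, ⋃ j : I m, closedCell (C := (univ : Set K)) m j.1) := by
    refine LocallyFinite.continuousOn_iUnion (locallyFinite_of_finite _) (fun m => ?_) (fun m => ?_)
    · exact isClosed_iUnion_of_finite fun j => isClosed_closedCell
    · exact LocallyFinite.continuousOn_iUnion (locallyFinite_of_finite _)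
        (fun j => isClosed_closedCell) (fun j => h m m.2 j)
  refine hc.comp ((RelCWComplex.continuousOn n e).mono sphere_subset_closedBall) ?_
  intro u hu
  have := hI hu
  simp only [mem_iUnion] at this ⊢
  obtain ⟨m, hm, j, hj, hx⟩ := this
  exact ⟨⟨m, hm⟩, ⟨j, hj⟩, hx⟩

/-- A map which is continuous on a subcomplex `K₀` and on the cells of dimension less than `n` can
be changed on the open `n`-cells outside `K₀` to be continuous on all `n`-cells, if its restriction
to the boundary of each such cell extends over the cell. -/
theorem exists_extend_cells (n : ℕ) (K₀ : RelCWComplex.Subcomplex (univ : Set K)) (f : K → Y)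
    (hf₀ : ContinuousOn f (K₀ : Set K))
    (hf : ∀ m < n, ∀ e : cell (univ : Set K) m, ContinuousOn f (closedCell m e))
    (Q : K → Y → Prop) (hQ : ∀ x, Q x (f x))
    (hext : ∀ e : cell (univ : Set K) n, ContinuousOn (f ∘ map n e) (sphere 0 1) →
      ∃ g : (Fin n → ℝ) → Y, ContinuousOn g (closedBall 0 1) ∧
        (∀ u ∈ sphere (0 : Fin n → ℝ) 1, g u = f (map n e u)) ∧
        ∀ u ∈ closedBall (0 : Fin n → ℝ) 1, Q (map n e u) (g u)) :
    ∃ f' : K → Y, EqOn f' f (K₀ : Set K) ∧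
      (∀ m < n + 1, ∀ e : cell (univ : Set K) m, ContinuousOn f' (closedCell m e)) ∧
      ∀ x, Q x (f' x) := by
  classical
  choose g hgc hgs hgQ using fun e => hext e (continuousOn_comp_map_sphere hf e)
  -- Distinct open `n`-cells are disjoint, so the choice of the cell is forced; the inverse of `map`
  -- is meaningful only on open cells, and the sphere keeps the values of `f`.
  let f' : K → Y := fun x =>
    if h : ∃ e : cell (univ : Set K) n, e ∉ K₀.I n ∧ x ∈ openCell n e then
      g h.choose ((map n h.choose).symm x) else f x
  have hf'cell : ∀ e : cell (univ : Set K) n, e ∉ K₀.I n → ∀ u ∈ ball (0 : Fin n → ℝ) 1,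
      f' (map n e u) = g e u := by
    intro e he u hu
    have h : ∃ e' : cell (univ : Set K) n, e' ∉ K₀.I n ∧ map n e u ∈ openCell n e' :=
      ⟨e, he, mem_image_of_mem _ hu⟩
    have hee : h.choose = e := by
      by_contra hne
      have hd := CWComplex.disjoint_openCell_of_ne (C := (univ : Set K)) (n := n) (m := n)
        (i := h.choose) (j := e) (by simpa using hne)
      exact disjoint_left.1 hd h.choose_spec.2 (mem_image_of_mem _ hu)
    simp only [f', dif_pos h]
    rw [hee, (map n e).left_inv (by rw [source_eq]; exact hu)]
  have hf'else : ∀ x, (∀ e : cell (univ : Set K) n, e ∉ K₀.I n → x ∉ openCell n e) →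
      f' x = f x := by
    intro x hx
    have h : ¬ ∃ e : cell (univ : Set K) n, e ∉ K₀.I n ∧ x ∈ openCell n e := by
      rintro ⟨e, he, hxe⟩
      exact hx e he hxe
    simp only [f', dif_neg h]
  have hK₀ : EqOn f' f (K₀ : Set K) := fun x hx => hf'else x fun e he hxe =>
    disjoint_left.1 (RelCWComplex.Subcomplex.disjoint_openCell_subcomplex_of_not_mem K₀ he) hxe hx
  have hlow : ∀ m < n, ∀ e : cell (univ : Set K) m, EqOn f' f (closedCell m e) := by
    intro m hm e x hx
    refine hf'else x fun e' _ hxe => ?_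
    -- An open `n`-cell misses the subcomplex of all cells of dimension below `n`.
    have hd := (RelCWComplex.skeletonLT (univ : Set K) n).disjoint_openCell_subcomplex_of_not_mem
      (n := n) (i := e') (by simp [RelCWComplex.skeletonLT, RelCWComplex.Subcomplex.mk'])
    refine disjoint_left.1 hd hxe ?_
    rw [RelCWComplex.coe_skeletonLT]
    refine Or.inr ?_
    simp only [mem_iUnion]
    exact ⟨m, by exact_mod_cast hm, e, hx⟩
  refine ⟨f', hK₀, ?_, ?_⟩
  · intro m hm e
    rcases Nat.lt_succ_iff_lt_or_eq.1 hm with hm | rfl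
    · exact (hf m hm e).congr (hlow m hm e)
    · by_cases he : e ∈ K₀.I m
      · have hs := RelCWComplex.Subcomplex.closedCell_subset_of_mem K₀ he
        exact (hf₀.mono hs).congr (hK₀.mono hs)
      · rw [continuousOn_closedCell_iff]
        refine (hgc e).congr fun u hu => ?_
        rcases (mem_closedBall_zero_iff.1 hu).lt_or_eq with h | h
        · exact hf'cell e he u (mem_ball_zero_iff.2 h)
        · have hu' : u ∈ sphere (0 : Fin m → ℝ) 1 := mem_sphere_zero_iff_norm.2 h
          rw [hgs e u hu']
          obtain ⟨I, hI⟩ := CWComplex.mapsTo (C := (univ : Set K)) m e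
          have := hI hu'
          simp only [mem_iUnion] at this
          obtain ⟨k, hk, j, -, hx⟩ := this
          exact hlow k hk j hx
  · intro x
    by_cases h : ∃ e : cell (univ : Set K) n, e ∉ K₀.I n ∧ x ∈ openCell n e
    · obtain ⟨e, he, u, hu, rfl⟩ := h
      rw [hf'cell e he u hu]
      exact hgQ e u (ball_subset_closedBall hu)
    · rw [hf'else x fun e he hxe => h ⟨e, he, hxe⟩]
      exact hQ x

end CW

open unitInterval

/-! ### Loops in the plane -/

/-- The norm is the maximum norm, so for `n = 2` the sphere is the boundary of a square and lies on
four lines; for smaller `n` the ambient space already has dimension below 2. -/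
theorem dimH_sphere_pi_lt_two {n : ℕ} (hn : n ≤ 2) : dimH (sphere (0 : Fin n → ℝ) 1) < 2 := by
  rcases hn.lt_or_eq with h | rfl
  · calc dimH (sphere (0 : Fin n → ℝ) 1) ≤ dimH (univ : Set (Fin n → ℝ)) :=
          dimH_mono (subset_univ _)
      _ = n := Real.dimH_univ_pi_fin n
      _ < 2 := by exact_mod_cast h
  · have hline : ∀ f : ℝ → Fin 2 → ℝ, ContDiff ℝ 1 f → dimH (range f) ≤ 1 := fun f hf => by
      simpa using hf.dimH_range_le
    have hsub : sphere (0 : Fin 2 → ℝ) 1 ⊆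
        (range fun t : ℝ => ![1, t]) ∪ (range fun t : ℝ => ![-1, t]) ∪
          ((range fun t : ℝ => ![t, 1]) ∪ (range fun t : ℝ => ![t, -1])) := by
      intro x hx
      obtain ⟨i, hi⟩ : ∃ i, |x i| = 1 := by
        by_contra! h
        have h1 : ‖x‖ = 1 := mem_sphere_zero_iff_norm.1 hx
        have h2 : ‖x‖ < 1 := (pi_norm_lt_iff one_pos).2 fun i =>
          lt_of_le_of_ne ((norm_le_pi_norm x i).trans h1.le) (h i)
        linarith
      have hx' : x = ![x 0, x 1] := by
        ext j; fin_cases j <;> rfl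
      fin_cases i
      · rcases (abs_eq one_pos.le).1 hi with h | h <;> simp only [Fin.zero_eta] at h
        · exact Or.inl (Or.inl ⟨x 1, by rw [hx', h]; rfl⟩)
        · exact Or.inl (Or.inr ⟨x 1, by rw [hx', h]; rfl⟩)
      · rcases (abs_eq one_pos.le).1 hi with h | h <;> simp only [Fin.mk_one] at h
        · exact Or.inr (Or.inl ⟨x 0, by rw [hx', h]; rfl⟩)
        · exact Or.inr (Or.inr ⟨x 0, by rw [hx', h]; rfl⟩)
    refine ((dimH_mono hsub).trans ?_).trans_lt (by norm_num : (1 : ENNReal) < 2)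
    simp only [dimH_union, max_le_iff]
    refine ⟨⟨hline _ ?_, hline _ ?_⟩, hline _ ?_, hline _ ?_⟩ <;>
    · rw [contDiff_pi]
      intro i
      fin_cases i
      · simp; fun_prop
      · simp; fun_prop

/-- A map from the boundary of a cube of dimension at most `2` to the plane can be moved off the
origin by an arbitrarily small perturbation. -/
theorem exists_near_ne_zero {n : ℕ} (hn : n ≤ 2) {ζ : (Fin n → ℝ) → ℂ}
    (hζ : ContinuousOn ζ (sphere 0 1)) {ε : ℝ} (hε : 0 < ε) :
    ∃ g : (Fin n → ℝ) → ℂ, Continuous g ∧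
      ∀ u ∈ sphere (0 : Fin n → ℝ) 1, g u ≠ 0 ∧ ‖g u - ζ u‖ < ε := by
  obtain ⟨G, hG⟩ := ContinuousMap.exists_restrict_eq (isClosed_sphere (x := (0 : Fin n → ℝ)) (ε := 1))
    ⟨_, hζ.domRestrict⟩
  obtain ⟨h, hh, hhG, -⟩ := G.continuous.exists_contDiff_approx 1
    (continuous_const (y := ε / 2)) (fun _ => half_pos hε)
  -- A C¹ map does not raise Hausdorff dimension, so the image of the sphere misses points `v`
  -- arbitrarily close to 0; translating by such a `v` frees the origin.
  have hd : Dense (h '' sphere (0 : Fin n → ℝ) 1)ᶜ :=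
    ContDiffOn.dense_compl_image_of_dimH_lt_finrank (s := univ) hh.contDiffOn convex_univ
      (subset_univ _) (by simpa using dimH_sphere_pi_lt_two hn)
  obtain ⟨v, hv, hv0⟩ := Metric.dense_iff.1 hd 0 (ε / 2) (half_pos hε)
  refine ⟨fun u => h u - v, hh.continuous.sub continuous_const, fun u hu => ⟨?_, ?_⟩⟩
  · intro h0
    exact hv0 ⟨u, hu, sub_eq_zero.1 h0⟩
  · have h1 : G u = ζ u := DFunLike.congr_fun hG ⟨u, hu⟩
    have h2 := hhG u
    rw [dist_eq_norm, h1] at h2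
    have h3 : ‖v‖ < ε / 2 := mem_ball_zero_iff.1 hv
    calc ‖h u - v - ζ u‖ = ‖(h u - ζ u) - v‖ := by congr 1; ring
      _ ≤ ‖h u - ζ u‖ + ‖v‖ := norm_sub_le _ _
      _ < ε := by linarith

/-- A map from the boundary of a cube of dimension at most `2` to the plane agrees with a map to the
unit circle wherever its value lies on the unit circle. -/
theorem exists_norm_eq_one {n : ℕ} (hn : n ≤ 2) {ζ : (Fin n → ℝ) → ℂ}
    (hζ : ContinuousOn ζ (sphere 0 1)) :
    ∃ g : (Fin n → ℝ) → ℂ, ContinuousOn g (sphere 0 1) ∧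
      ∀ u ∈ sphere (0 : Fin n → ℝ) 1, ‖g u‖ = 1 ∧ (‖ζ u‖ = 1 → g u = ζ u) := by
  obtain ⟨h, hhc, hh⟩ := exists_near_ne_zero hn hζ (by norm_num : (0 : ℝ) < 1 / 4)
  -- The cutoff is 0 for `‖ζ‖ ≤ 1/2` and 1 for `‖ζ‖ ≥ 3/4`. Where it is positive, `h` is within 1/4
  -- of `ζ`, so the segment between them avoids 0.
  let l : (Fin n → ℝ) → ℝ := fun u => max 0 (min 1 (4 * ‖ζ u‖ - 2))
  have hl : ContinuousOn l (sphere 0 1) := by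
    have hc : Continuous fun t : ℝ => max 0 (min 1 (4 * t - 2)) := by fun_prop
    exact hc.comp_continuousOn hζ.norm
  let k : (Fin n → ℝ) → ℂ := fun u => (l u : ℂ) * ζ u + (1 - l u : ℂ) * h u
  have hlC : ContinuousOn (fun u => (l u : ℂ)) (sphere 0 1) :=
    Complex.continuous_ofReal.comp_continuousOn hl
  have hk : ContinuousOn k (sphere 0 1) :=
    (hlC.mul hζ).add ((continuousOn_const.sub hlC).mul hhc.continuousOn)
  have hk0 : ∀ u ∈ sphere (0 : Fin n → ℝ) 1, k u ≠ 0 := by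
    intro u hu
    obtain ⟨h0, h1⟩ := hh u hu
    rcases le_or_gt ‖ζ u‖ (1 / 2) with hs | hs
    · have : l u = 0 := max_eq_left ((min_le_right _ _).trans (by linarith))
      simpa [k, this] using h0
    · intro hk0
      have hl0 : 0 ≤ l u := le_max_left _ _
      have hl1 : l u ≤ 1 := max_le zero_le_one (min_le_left _ _)
      have e : ζ u = ((1 - l u : ℝ) : ℂ) * (ζ u - h u) + k u := by
        simp only [k]; push_cast; ring
      have : ‖ζ u‖ ≤ 1 / 4 := by
        rw [e, hk0, add_zero, norm_mul, Complex.norm_real, Real.norm_eq_abs,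
          abs_of_nonneg (by linarith), norm_sub_rev]
        nlinarith [norm_nonneg (h u - ζ u)]
      linarith
  refine ⟨fun u => k u / (‖k u‖ : ℂ), ?_, fun u hu => ⟨?_, fun hu1 => ?_⟩⟩
  · exact hk.div (Complex.continuous_ofReal.comp_continuousOn hk.norm) fun u hu => by
      simpa using hk0 u hu
  · rw [norm_div, Complex.norm_real, norm_norm, div_self (norm_ne_zero_iff.2 (hk0 u hu))]
  · have hl1 : l u = 1 := by simp only [l, hu1]; norm_num
    have : k u = ζ u := by simp [k, hl1]
    change k u / (‖k u‖ : ℂ) = ζ u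
    rw [this, hu1, Complex.ofReal_one, div_one]

/-! ### Radial extension -/

section Radial

variable {E : Type*} [NormedAddCommGroup E] [NormedSpace ℝ E]

theorem norm_inv_smul_mem_sphere {u : E} (hu : u ≠ 0) : ‖u‖⁻¹ • u ∈ sphere (0 : E) 1 := by
  rw [mem_sphere_zero_iff_norm, norm_smul, norm_inv, norm_norm,
    inv_mul_cancel₀ (norm_ne_zero_iff.2 hu)]

theorem continuousOn_comp_radial {Y : Type*} [TopologicalSpace Y] {f : E → Y}
    (hf : ContinuousOn f (sphere 0 1)) : ContinuousOn (fun u => f (‖u‖⁻¹ • u)) {u | u ≠ 0} := by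
  refine hf.comp ?_ fun u hu => norm_inv_smul_mem_sphere hu
  exact (continuous_norm.continuousOn.inv₀ fun u hu => norm_ne_zero_iff.2 hu).smul continuousOn_id

/-- This is the cone on `f`: at the origin the factor `‖u‖` beats the bound `C`, and elsewhere the
radial projection is continuous. -/
theorem continuous_norm_smul_radial {F : Type*} [NormedAddCommGroup F] [NormedSpace ℝ F] {f : E → F}
    (hf : ContinuousOn f (sphere 0 1)) {C : ℝ} (hC : ∀ u ∈ sphere (0 : E) 1, ‖f u‖ ≤ C) :
    Continuous fun u => ‖u‖ • f (‖u‖⁻¹ • u) := by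
  rw [continuous_iff_continuousAt]
  intro u
  by_cases hu : u = 0
  · subst hu
    have hle : ∀ v : E, ‖‖v‖ • f (‖v‖⁻¹ • v)‖ ≤ ‖v‖ * C := by
      intro v
      by_cases hv : v = 0
      · simp [hv]
      · rw [norm_smul, norm_norm]
        exact mul_le_mul_of_nonneg_left (hC _ (norm_inv_smul_mem_sphere hv)) (norm_nonneg _)
    have h0 : Filter.Tendsto (fun v : E => ‖v‖ * C) (𝓝 0) (𝓝 0) := by
      have : Continuous fun v : E => ‖v‖ * C := by fun_prop
      simpa using this.tendsto 0
    simpa [ContinuousAt] using squeeze_zero_norm hle h0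
  · have ho : IsOpen {u : E | u ≠ 0} := isOpen_ne
    exact (continuous_norm.continuousOn.smul (continuousOn_comp_radial hf)).continuousAt
      (ho.mem_nhds hu)

theorem norm_radial_clamp {u : E} (c : ℝ) : ‖(c / ‖u‖) • u‖ ≤ |c| := by
  rw [norm_smul, norm_div, norm_norm, Real.norm_eq_abs]
  by_cases hu : u = 0
  · simp [hu]
  · rw [div_mul_cancel₀ _ (norm_ne_zero_iff.2 hu)]

end Radial

/-! ### Collapses along the fibres and maps of cells -/

/-- A deformation retraction of `M` onto a subspace `B` along the fibres of the retraction, together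
with a subspace `bd` of `M` which can be reached from every point of `B` inside its fibre. -/
structure FiberwiseCollapse (M B : Type*) [TopologicalSpace M] [TopologicalSpace B] where
  incl : C(B, M)
  retr : C(M, B)
  flow : C(I × M, M)
  bd : Set M
  retr_incl : ∀ y, retr (incl y) = y
  flow_zero : ∀ x, flow (0, x) = x
  flow_one : ∀ x, flow (1, x) = incl (retr x)
  retr_flow : ∀ t x, retr (flow (t, x)) = retr x
  exists_leg : ∀ y, ∃ γ : C(I, M), γ 0 = incl y ∧ (∀ s, retr (γ s) = y) ∧ γ 1 ∈ bd

namespace FiberwiseCollapse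

variable {M B : Type*} [TopologicalSpace M]

/-- The subspace `bd × D² ∪ M × S¹` of `M × D²`. -/
def Boundary [TopologicalSpace B] (c : FiberwiseCollapse M B) : Type _ :=
  {q : M × ℂ // (q.1 ∈ c.bd ∧ ‖q.2‖ ≤ 1) ∨ ‖q.2‖ = 1}

instance [TopologicalSpace B] (c : FiberwiseCollapse M B) : TopologicalSpace c.Boundary :=
  inferInstanceAs (TopologicalSpace {q : M × ℂ // (q.1 ∈ c.bd ∧ ‖q.2‖ ≤ 1) ∨ ‖q.2‖ = 1})

/-- The projection of `bd × D² ∪ M × S¹` to `M`, followed by the retraction onto `B`. -/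
def proj [TopologicalSpace B] (c : FiberwiseCollapse M B) : C(c.Boundary, B) :=
  ⟨fun q => c.retr q.1.1, c.retr.continuous.comp (continuous_fst.comp continuous_subtype_val)⟩

/-- A section of `proj`. -/
def lift [TopologicalSpace B] (c : FiberwiseCollapse M B) : C(B, c.Boundary) :=
  ⟨fun y => ⟨(c.incl y, 1), Or.inr (by simp)⟩,
    (c.incl.continuous.prodMk continuous_const).subtype_mk _⟩

theorem proj_lift [TopologicalSpace B] (c : FiberwiseCollapse M B) (y : B) :
    c.proj (c.lift y) = y := c.retr_incl y

/-- The radial map of the unit ball onto itself which collapses a small ball about the origin to a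
point and a thin collar of the boundary to the boundary. -/
def radialStretch {E : Type*} [NormedAddCommGroup E] [NormedSpace ℝ E] (κ : ℝ) (u : E) : E :=
  (max 0 (min 1 ((‖u‖ - 2 * κ) / (1 - 4 * κ))) / max ‖u‖ κ) • u

section Stretch

variable {E : Type*} [NormedAddCommGroup E] [NormedSpace ℝ E] {κ : ℝ}

/-- The maximum in the denominator keeps it positive. For `κ ≤ 1/8` it changes nothing else, since
the numerator vanishes for `‖u‖ ≤ 2κ`. -/
theorem continuous_radialStretch (hκ : 0 < κ) : Continuous (radialStretch κ : E → E) := by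
  unfold radialStretch
  refine Continuous.smul (Continuous.div ?_ ?_ ?_) continuous_id
  · fun_prop
  · fun_prop
  · intro u
    exact (lt_max_of_lt_right hκ).ne'

theorem radialStretch_of_le (hκ : κ ≤ 1 / 8) {u : E} (hu : ‖u‖ ≤ 2 * κ) :
    radialStretch κ u = 0 := by
  have : (‖u‖ - 2 * κ) / (1 - 4 * κ) ≤ 0 :=
    div_nonpos_of_nonpos_of_nonneg (by linarith) (by linarith)
  rw [radialStretch, max_eq_left ((min_le_right _ _).trans this), zero_div, zero_smul]

theorem radialStretch_of_ge (hκ : κ ≤ 1 / 8) {u : E} (hu : 1 - 2 * κ ≤ ‖u‖) :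
    radialStretch κ u = ‖u‖⁻¹ • u := by
  have : 1 ≤ (‖u‖ - 2 * κ) / (1 - 4 * κ) := (one_le_div (by linarith)).2 (by linarith)
  rw [radialStretch, min_eq_left this, max_eq_right zero_le_one, max_eq_left (by linarith), one_div]

theorem dist_radialStretch_le (hκ0 : 0 < κ) (hκ : κ ≤ 1 / 8) {u : E} (hu : ‖u‖ ≤ 1) :
    dist (radialStretch κ u) u ≤ 4 * κ := by
  rcases le_or_gt ‖u‖ (2 * κ) with h | h
  · rw [radialStretch_of_le hκ h, dist_zero_left]; linarith
  · have hu0 : 0 < ‖u‖ := by linarith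
    have hd : 0 < 1 - 4 * κ := by linarith
    have e : ∀ t : ℝ, (t / ‖u‖) • u - u = ((t - ‖u‖) / ‖u‖) • u := fun t => by
      rw [sub_div, div_self hu0.ne', sub_smul, one_smul]
    rw [dist_eq_norm, radialStretch, max_eq_left (a := ‖u‖) (by linarith), e]
    refine (norm_radial_clamp _).trans ?_
    have h0 : 0 ≤ (‖u‖ - 2 * κ) / (1 - 4 * κ) := div_nonneg (by linarith) hd.le
    rcases le_total 1 ((‖u‖ - 2 * κ) / (1 - 4 * κ)) with h1 | h1
    · have h2 := (one_le_div hd).1 h1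
      rw [min_eq_left h1, max_eq_right zero_le_one, abs_le]
      constructor <;> linarith
    · rw [min_eq_right h1, max_eq_right h0, abs_le]
      -- For `‖u‖ ≤ 1` this is at most `2κ / (1 - 4κ)` in absolute value, and `κ ≤ 1/8` makes the
      -- denominator at least 1/2.
      have h2 : (‖u‖ - 2 * κ) / (1 - 4 * κ) - ‖u‖ = (4 * ‖u‖ - 2) * κ / (1 - 4 * κ) := by
        rw [eq_div_iff hd.ne', sub_mul, div_mul_cancel₀ _ hd.ne']; ring
      rw [h2, le_div_iff₀ hd, div_le_iff₀ hd]
      constructor <;> nlinarith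

theorem norm_radialStretch_le (hκ : 0 < κ) (u : E) : ‖radialStretch κ u‖ ≤ 1 := by
  have hm : 0 < max ‖u‖ κ := lt_max_of_lt_right hκ
  rw [radialStretch, norm_smul, norm_div, Real.norm_eq_abs, Real.norm_eq_abs, abs_of_pos hm,
    div_mul_eq_mul_div, div_le_one hm, abs_of_nonneg (le_max_left _ _)]
  calc _ ≤ 1 * ‖u‖ := mul_le_mul_of_nonneg_right (max_le zero_le_one (min_le_left _ _))
        (norm_nonneg _)
    _ ≤ _ := by rw [one_mul]; exact le_max_left _ _

end Stretch

/-- A lift of the boundary of a cell of dimension at most `2` extends to a lift of the cell, up to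
a small change of the parameter of the cell. -/
theorem exists_cell_lift [TopologicalSpace B] (c : FiberwiseCollapse M B) {n : ℕ} (hn : n ≤ 2)
    {α : (Fin n → ℝ) → B} (hα : Continuous α) {β : (Fin n → ℝ) → c.Boundary}
    (hβ : ContinuousOn β (sphere 0 1)) (hp : ∀ u ∈ sphere (0 : Fin n → ℝ) 1, c.proj (β u) = α u)
    {η : ℝ} (hη : 0 < η) :
    ∃ (β' : (Fin n → ℝ) → c.Boundary) (F : (Fin n → ℝ) → (Fin n → ℝ)),
      ContinuousOn β' (closedBall 0 1) ∧ Continuous F ∧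
      (∀ u ∈ sphere (0 : Fin n → ℝ) 1, β' u = β u ∧ F u = u) ∧
      ∀ u ∈ closedBall (0 : Fin n → ℝ) 1,
        c.proj (β' u) = α (F u) ∧ F u ∈ closedBall 0 1 ∧ dist (F u) u ≤ η := by
  classical
  set S := sphere (0 : Fin n → ℝ) 1 with hS
  obtain ⟨κ, hκ0, hκ, hκη⟩ : ∃ κ : ℝ, 0 < κ ∧ κ ≤ 1 / 8 ∧ 4 * κ ≤ η :=
    ⟨min (1 / 8) (η / 4), lt_min (by norm_num) (by linarith), min_le_left _ _,
      by linarith [min_le_right (1 / 8) (η / 4)]⟩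
  let x : (Fin n → ℝ) → M := fun u => (β u).1.1
  let ζ : (Fin n → ℝ) → ℂ := fun u => (β u).1.2
  have hβ' : ContinuousOn (fun u => (β u).1) S := continuous_subtype_val.comp_continuousOn hβ
  have hx : ContinuousOn x S := continuous_fst.comp_continuousOn hβ'
  have hζ : ContinuousOn ζ S := continuous_snd.comp_continuousOn hβ'
  have hζ1 : ∀ u, ‖ζ u‖ ≤ 1 := fun u => (β u).2.elim (fun h => h.2) (fun h => h.le)
  obtain ⟨ω, hω, hω1⟩ := exists_norm_eq_one hn hζ
  obtain ⟨γ, hγ0, hγ, hγ1⟩ := c.exists_leg (α 0)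
  let pr : ℝ → I := projIcc 0 1 zero_le_one
  have hpr : Continuous pr := continuous_projIcc
  have hpr0 : ∀ t ≤ 0, pr t = 0 := fun t ht => projIcc_of_le_left _ ht
  have hpr1 : ∀ t, 1 ≤ t → pr t = 1 := fun t ht => projIcc_of_right_le _ ht
  let r : (Fin n → ℝ) → (Fin n → ℝ) := fun u => ‖u‖⁻¹ • u
  have hrS : ∀ u, 0 < ‖u‖ → r u ∈ S := fun u hu => norm_inv_smul_mem_sphere (norm_pos_iff.1 hu)
  have hr1 : ∀ u ∈ S, r u = u := fun u hu => by
    have : ‖u‖ = 1 := mem_sphere_zero_iff_norm.1 hu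
    simp [r, this]
  let F : (Fin n → ℝ) → (Fin n → ℝ) := radialStretch κ
  have hF : Continuous F := continuous_radialStretch hκ0
  -- the component in the disc
  let s : (Fin n → ℝ) → I := fun u => pr ((1 - ‖u‖) / κ)
  have hs : Continuous s := hpr.comp (by fun_prop)
  -- The disc coordinate runs from `ζ` to `ω` in the outermost layer of width `κ`, stays on the
  -- circle as far in as radius `κ`, and is coned off inside.
  let Zo : (Fin n → ℝ) → ℂ := fun u => (1 - (s u : ℝ)) • ζ (r u) + (s u : ℝ) • ω (r u)
  let Z : (Fin n → ℝ) → ℂ := fun u => if ‖u‖ ≤ κ then κ⁻¹ • (‖u‖ • ω (r u)) else Zo u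
  have hsκ : ∀ u, ‖u‖ ≤ 1 - κ → s u = 1 := fun u hu =>
    hpr1 _ ((one_le_div hκ0).2 (by linarith))
  have hZoω : ∀ u, ‖u‖ ≤ 1 - κ → Zo u = ω (r u) := fun u hu => by simp [Zo, hsκ u hu]
  have hne : ∀ {a : ℝ}, 0 < a → {u : Fin n → ℝ | a ≤ ‖u‖} ⊆ {u | u ≠ 0} := fun ha u hu =>
    norm_pos_iff.1 (ha.trans_le hu)
  have hZ : Continuous Z := by
    refine continuous_if_le continuous_norm continuous_const ?_ ?_ ?_
    · exact ((continuous_const (y := κ⁻¹)).smul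
        (continuous_norm_smul_radial hω (C := 1) fun u hu => (hω1 u hu).1.le)).continuousOn
    · have hsR : Continuous fun u => (s u : ℝ) := continuous_subtype_val.comp hs
      exact ((continuous_const.sub hsR).continuousOn.smul
        ((continuousOn_comp_radial hζ).mono (hne hκ0))).add
        (hsR.continuousOn.smul ((continuousOn_comp_radial hω).mono (hne hκ0)))
    · intro u hu
      rw [hZoω u (by linarith), hu, smul_smul, inv_mul_cancel₀ hκ0.ne', one_smul]
  -- the component in `M`
  let b : (Fin n → ℝ) → M := fun u =>
    if ‖u‖ ≤ 2 * κ then γ (pr (2 - ‖u‖ / κ)) else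
      if ‖u‖ ≤ 1 - 2 * κ then c.incl (α (F u)) else c.flow (pr ((1 - κ - ‖u‖) / κ), x (r u))
  have hFin : ∀ u, ‖u‖ ≤ 2 * κ → F u = 0 := fun u hu => radialStretch_of_le hκ hu
  have hFout : ∀ u, 1 - 2 * κ ≤ ‖u‖ → F u = r u := fun u hu => radialStretch_of_ge hκ hu
  have hb : Continuous b := by
    refine continuous_if_le continuous_norm continuous_const ?_ ?_ ?_
    · exact (γ.continuous.comp (hpr.comp (by fun_prop))).continuousOn
    · refine Continuous.continuousOn ?_
      refine continuous_if_le continuous_norm continuous_const ?_ ?_ ?_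
      · exact (c.incl.continuous.comp (hα.comp hF)).continuousOn
      · refine c.flow.continuous.comp_continuousOn (ContinuousOn.prodMk ?_ ?_)
        · exact (hpr.comp (by fun_prop)).continuousOn
        · exact (continuousOn_comp_radial hx).mono (hne (by linarith))
      · intro u hu
        rw [hFout u hu.ge, hpr1 _ ((one_le_div hκ0).2 (by linarith)), c.flow_one]
        congr 1
        exact (hp _ (hrS u (by linarith))).symm
    · intro u hu
      have h1 : ‖u‖ / κ = 2 := by rw [hu, mul_div_cancel_right₀ _ hκ0.ne']
      rw [h1, hpr0 _ (by norm_num), hγ0, if_pos (by linarith), hFin u hu.le]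
  have hmem : ∀ u, (b u ∈ c.bd ∧ ‖Z u‖ ≤ 1) ∨ ‖Z u‖ = 1 := by
    intro u
    rcases le_or_gt ‖u‖ κ with h | h
    · left
      have h1 : b u = γ 1 := by
        simp only [b]
        rw [if_pos (by linarith), hpr1]
        have := (div_le_one hκ0).2 h
        linarith
      refine ⟨h1 ▸ hγ1, ?_⟩
      simp only [Z, if_pos h]
      by_cases hu : ‖u‖ = 0
      · simp [hu]
      · have hu0 : 0 < ‖u‖ := lt_of_le_of_ne (norm_nonneg _) (Ne.symm hu)
        rw [norm_smul, norm_smul, (hω1 _ (hrS u hu0)).1, norm_inv, norm_norm, mul_one,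
          Real.norm_eq_abs, abs_of_pos hκ0, inv_mul_le_iff₀ hκ0, mul_one]
        exact h
    · have hu0 : 0 < ‖u‖ := hκ0.trans h
      have hZu : Z u = Zo u := if_neg (not_le.2 h)
      rw [hZu]
      rcases le_or_gt ‖u‖ (1 - κ) with h' | h'
      · right
        rw [hZoω u h']
        exact (hω1 _ (hrS u hu0)).1
      · have hbu : b u = x (r u) := by
          simp only [b]
          rw [if_neg (by linarith), if_neg (by linarith),
            hpr0 _ (div_nonpos_of_nonpos_of_nonneg (by linarith) hκ0.le), c.flow_zero]
        rw [hbu]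
        obtain ⟨hω2, hω3⟩ := hω1 _ (hrS u hu0)
        have hs0 : 0 ≤ (s u : ℝ) := (s u).2.1
        have hs1 : (s u : ℝ) ≤ 1 := (s u).2.2
        -- In the outermost layer either the base point is in `bd`, where the whole convex disc is
        -- allowed, or `ω = ζ` and the disc coordinate does not move.
        rcases (β (r u)).2 with ⟨hbd, hle⟩ | h1
        · left
          refine ⟨hbd, (norm_add_le _ _).trans ?_⟩
          rw [norm_smul, norm_smul, hω2, Real.norm_eq_abs, Real.norm_eq_abs, abs_of_nonneg hs0,
            abs_of_nonneg (by linarith)]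
          have := hζ1 (r u)
          nlinarith
        · right
          have : Zo u = ζ (r u) := by
            simp only [Zo]
            rw [hω3 h1, ← add_smul, sub_add_cancel, one_smul]
          rw [this]
          exact h1
  refine ⟨fun u => ⟨(b u, Z u), hmem u⟩, F, ((hb.prodMk hZ).subtype_mk hmem).continuousOn, hF, ?_, ?_⟩
  · intro u hu
    have hu1 : ‖u‖ = 1 := mem_sphere_zero_iff_norm.1 hu
    constructor
    · refine Subtype.ext (Prod.ext ?_ ?_)
      · simp only [b]
        rw [if_neg (by linarith), if_neg (by linarith),
            hpr0 _ (div_nonpos_of_nonpos_of_nonneg (by linarith) hκ0.le), c.flow_zero, hr1 u hu]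
      · simp only [Z]
        have : s u = 0 := hpr0 _ (by simp [hu1])
        rw [if_neg (by linarith)]
        simp only [Zo, this, hr1 u hu]
        simp [ζ]
    · rw [hFout u (by linarith), hr1 u hu]
  · intro u hu
    have hu1 : ‖u‖ ≤ 1 := mem_closedBall_zero_iff.1 hu
    refine ⟨?_, mem_closedBall_zero_iff.2 (norm_radialStretch_le hκ0 u),
      (dist_radialStretch_le hκ0 hκ hu1).trans hκη⟩
    change c.retr (b u) = _
    simp only [b]
    split_ifs with h1 h2
    · rw [hγ, hFin u h1]
    · rw [c.retr_incl]
    · rw [c.retr_flow, hFout u (by linarith)]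
      exact hp _ (hrS u (by linarith))

/-! ### Approximate lifts over a metric base and the cellwise induction -/

section Metric

variable [MetricSpace B]

/-- A continuous map on the closed unit ball extends continuously to the whole space. -/
theorem exists_continuous_eqOn_closedBall {E Y : Type*} [NormedAddCommGroup E] [NormedSpace ℝ E]
    [TopologicalSpace Y] {f : E → Y} (hf : ContinuousOn f (closedBall 0 1)) :
    ∃ g : E → Y, Continuous g ∧ EqOn g f (closedBall 0 1) := by
  have hc : Continuous fun u : E => (max 1 ‖u‖)⁻¹ • u :=
    ((continuous_const.max continuous_norm).inv₀ fun u =>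
      (lt_max_of_lt_left one_pos).ne').smul continuous_id
  refine ⟨fun u => f ((max 1 ‖u‖)⁻¹ • u), hf.comp_continuous hc fun u => ?_, fun u hu => ?_⟩
  · have hm : 0 < max 1 ‖u‖ := lt_max_of_lt_left one_pos
    rw [mem_closedBall_zero_iff, norm_smul, norm_inv, Real.norm_eq_abs, abs_of_pos hm,
      inv_mul_le_iff₀ hm, mul_one]
    exact le_max_right _ _
  · have : max 1 ‖u‖ = 1 := max_eq_left (mem_closedBall_zero_iff.1 hu)
    simp [this]

theorem exists_uniform_closedBall {n : ℕ} {α : (Fin n → ℝ) → B} (hα : Continuous α) {δ : ℝ}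
    (hδ : 0 < δ) : ∃ η > 0, ∀ u ∈ closedBall (0 : Fin n → ℝ) 1, ∀ v ∈ closedBall (0 : Fin n → ℝ) 1,
      dist u v ≤ η → dist (α u) (α v) < δ := by
  have := (isCompact_closedBall (0 : Fin n → ℝ) 1).uniformContinuousOn_of_continuous hα.continuousOn
  obtain ⟨η, hη, h⟩ := Metric.uniformContinuousOn_iff.1 this δ hδ
  exact ⟨η / 2, half_pos hη, fun u hu v hv huv => h u hu v hv (huv.trans_lt (half_lt_self hη))⟩

/-- A lift of the boundary of a cell of dimension at most `2` extends to an approximate lift of the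
cell, together with small paths from the given map to the image of the lift. -/
theorem exists_cell_lift_path (c : FiberwiseCollapse M B) {n : ℕ} (hn : n ≤ 2)
    {α : (Fin n → ℝ) → B} (hα : Continuous α) {β : (Fin n → ℝ) → c.Boundary}
    (hβ : ContinuousOn β (sphere 0 1)) (hp : ∀ u ∈ sphere (0 : Fin n → ℝ) 1, c.proj (β u) = α u)
    {δ : ℝ} (hδ : 0 < δ) :
    ∃ g : (Fin n → ℝ) → c.Boundary × C(I, B), ContinuousOn g (closedBall 0 1) ∧
      (∀ u ∈ sphere (0 : Fin n → ℝ) 1, g u = (β u, ContinuousMap.const I (α u))) ∧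
      ∀ u ∈ closedBall (0 : Fin n → ℝ) 1, (g u).2 0 = α u ∧ (g u).2 1 = c.proj (g u).1 ∧
        ∀ t, dist ((g u).2 t) (α u) < δ := by
  obtain ⟨η, hη, hαη⟩ := exists_uniform_closedBall hα hδ
  obtain ⟨β', F, hβ', hF, hS, hB⟩ := c.exists_cell_lift hn hα hβ hp hη
  -- The image under `α` of the segment from `u` to `F u`; it is constant on the sphere, where `F u
  -- = u`.
  let P : C((Fin n → ℝ) × I, B) := ⟨fun q => α (q.1 + (q.2 : ℝ) • (F q.1 - q.1)), by fun_prop⟩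
  have hP : ∀ u t, P.curry u t = α (u + (t : ℝ) • (F u - u)) := fun u t => rfl
  refine ⟨fun u => (β' u, P.curry u), hβ'.prodMk P.curry.continuous.continuousOn, ?_, ?_⟩
  · intro u hu
    refine Prod.ext (hS u hu).1 (ContinuousMap.ext fun t => ?_)
    change P.curry u t = α u
    rw [hP, (hS u hu).2, sub_self, smul_zero, add_zero]
  · intro u hu
    obtain ⟨h1, h2, h3⟩ := hB u hu
    refine ⟨?_, ?_, fun t => ?_⟩
    · change P.curry u 0 = α u
      simp [hP]
    · change P.curry u 1 = c.proj (β' u)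
      simp [hP, h1]
    · change dist (P.curry u t) (α u) < δ
      rw [hP]
      refine hαη _ ?_ _ hu ?_
      · exact (convex_closedBall (0 : Fin n → ℝ) 1).add_smul_sub_mem hu h2 t.2
      · rw [dist_eq_norm, add_sub_cancel_left, norm_smul, ← dist_eq_norm, Real.norm_eq_abs,
          abs_of_nonneg t.2.1]
        have := t.2.2
        have := dist_nonneg (x := F u) (y := u)
        have := t.2.1
        nlinarith

/-- An approximate lift of the boundary of a cell of dimension at most `2`, together with small paths
from the given map to the image of the lift, extends to an approximate lift of the cell. -/
theorem exists_cell_lift_of_path (c : FiberwiseCollapse M B) {n : ℕ} (hn : n ≤ 2)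
    {α : (Fin n → ℝ) → B} (hα : Continuous α) {f : (Fin n → ℝ) → c.Boundary × C(I, B)}
    (hf : ContinuousOn f (sphere 0 1)) {δ : ℝ} (hδ : 0 < δ)
    (hfα : ∀ u ∈ sphere (0 : Fin n → ℝ) 1, (f u).2 0 = α u ∧ (f u).2 1 = c.proj (f u).1 ∧
        ∀ t, dist ((f u).2 t) (α u) < δ / 2) :
    ∃ g : (Fin n → ℝ) → c.Boundary, ContinuousOn g (closedBall 0 1) ∧
      (∀ u ∈ sphere (0 : Fin n → ℝ) 1, g u = (f u).1) ∧
      ∀ u ∈ closedBall (0 : Fin n → ℝ) 1, dist (c.proj (g u)) (α u) < δ := by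
  classical
  obtain ⟨κ', hκ', hακ'⟩ := exists_uniform_closedBall hα (by linarith : 0 < δ / 4)
  obtain ⟨κ, hκ0, hκ, hακ⟩ : ∃ κ > 0, κ ≤ 1 / 2 ∧ ∀ u ∈ closedBall (0 : Fin n → ℝ) 1,
      ∀ v ∈ closedBall (0 : Fin n → ℝ) 1, dist u v ≤ κ → dist (α u) (α v) < δ / 4 :=
    ⟨min (1 / 2) κ', lt_min (by norm_num) hκ', min_le_left _ _, fun u hu v hv h =>
      hακ' u hu v hv (h.trans (min_le_right _ _))⟩
  let pr : ℝ → I := projIcc 0 1 zero_le_one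
  have hpr : Continuous pr := continuous_projIcc
  have hpr0 : ∀ t ≤ 0, pr t = 0 := fun t ht => projIcc_of_le_left _ ht
  have hpr1 : ∀ t, 1 ≤ t → pr t = 1 := fun t ht => projIcc_of_right_le _ ht
  -- `α` is squeezed into the ball of radius `1 - κ` and the recorded paths fill the collar, so on
  -- the sphere `α'` is exactly the projection of the given lift.
  let α' : (Fin n → ℝ) → B := fun u =>
    if ‖u‖ ≤ 1 - κ then α ((1 - κ)⁻¹ • u) else (f (‖u‖⁻¹ • u)).2 (pr ((‖u‖ - 1 + κ) / κ))
  have hα' : Continuous α' := by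
    refine continuous_if_le continuous_norm continuous_const ?_ ?_ ?_
    · exact (hα.comp (by fun_prop)).continuousOn
    · have h1 : ContinuousOn (fun u => (f (‖u‖⁻¹ • u)).2) {u | 1 - κ ≤ ‖u‖} :=
        continuous_snd.comp_continuousOn ((continuousOn_comp_radial hf).mono fun u hu =>
          norm_pos_iff.1 ((by linarith : 0 < 1 - κ).trans_le hu))
      have h2 : Continuous fun u : Fin n → ℝ => pr ((‖u‖ - 1 + κ) / κ) := hpr.comp (by fun_prop)
      have h3 : Continuous fun q : C(I, B) × I => q.1 q.2 := continuous_eval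
      exact h3.comp_continuousOn (h1.prodMk h2.continuousOn)
    · intro u hu
      rw [hpr0 _ (by rw [hu]; simp), (hfα _ (norm_inv_smul_mem_sphere (norm_pos_iff.1
        (by rw [hu]; linarith)))).1, hu]
  -- The paths cost `δ/2` and the radial displacement `δ/4`; the last `δ/4` is reserved for the
  -- reparametrization of `α'`.
  have hαα' : ∀ u ∈ closedBall (0 : Fin n → ℝ) 1, dist (α' u) (α u) < 3 * δ / 4 := by
    intro u hu
    have hu1 : ‖u‖ ≤ 1 := mem_closedBall_zero_iff.1 hu
    have hκ1 : 0 < 1 - κ := by linarith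
    simp only [α']
    split_ifs with h
    · refine (hακ _ ?_ _ hu ?_).trans (by linarith)
      · rw [mem_closedBall_zero_iff, norm_smul, norm_inv, Real.norm_eq_abs, abs_of_pos hκ1,
          inv_mul_le_iff₀ hκ1, mul_one]
        exact h
      · have e : (1 - κ)⁻¹ • u - u = (κ * (1 - κ)⁻¹) • u := by
          have : κ * (1 - κ)⁻¹ = (1 - κ)⁻¹ - 1 := by field_simp; ring
          rw [this, sub_smul, one_smul]
        rw [dist_eq_norm, e, norm_smul, Real.norm_eq_abs, abs_of_pos (mul_pos hκ0 (inv_pos.2 hκ1)),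
          mul_assoc]
        have : (1 - κ)⁻¹ * ‖u‖ ≤ 1 := by rw [inv_mul_le_iff₀ hκ1, mul_one]; exact h
        nlinarith
    · have hu0 : 0 < ‖u‖ := by linarith
      have hm := norm_inv_smul_mem_sphere (norm_pos_iff.1 hu0)
      refine (dist_triangle _ (α (‖u‖⁻¹ • u)) _).trans_lt ?_
      have h1 := (hfα _ hm).2.2 (pr ((‖u‖ - 1 + κ) / κ))
      have h2 := hακ _ (sphere_subset_closedBall hm) _ hu (by
        have e : ‖u‖⁻¹ • u - u = ((1 - ‖u‖) / ‖u‖) • u := by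
          rw [sub_div, div_self hu0.ne', sub_smul, one_smul, one_div]
        rw [dist_eq_norm, e]
        refine (norm_radial_clamp _).trans ?_
        rw [abs_of_nonneg (by linarith)]
        linarith)
      linarith
  obtain ⟨η, hη, hα'η⟩ := exists_uniform_closedBall hα' (by linarith : 0 < δ / 4)
  obtain ⟨g, F, hg, -, hgS, hgB⟩ := c.exists_cell_lift hn hα'
    (continuous_fst.comp_continuousOn hf) (fun u hu => by
      have hu1 : ‖u‖ = 1 := mem_sphere_zero_iff_norm.1 hu
      simp only [α']
      rw [if_neg (by linarith), hu1, inv_one, one_smul, hpr1 _ (by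
        rw [sub_self, zero_add, div_self hκ0.ne']), (hfα u hu).2.1]
      rfl) hη
  refine ⟨g, hg, fun u hu => (hgS u hu).1, fun u hu => ?_⟩
  obtain ⟨h1, h2, h3⟩ := hgB u hu
  rw [h1]
  have h4 := hα'η _ h2 _ hu h3
  have h5 := hαα' u hu
  linarith [dist_triangle (α' (F u)) (α' u) (α u)]

open Topology.RelCWComplex in
/-- The boundary of the thickening of `M` collapses to `B` by a `UV¹`-map. -/
theorem isUVOneMap_proj (c : FiberwiseCollapse M B) : IsUVOneMap.{u} c.proj := by
  classical
  refine ⟨c.proj.continuous, fun δ hδ K _ _ _ hK K₀ α₀ α hα₀ => ?_⟩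
  -- Off `K₀` the section gives some point over `α x`. No continuity is needed there, since every
  -- 0-cell is a single point and higher cells are overwritten.
  let f₀ : K → c.Boundary × C(I, B) := fun x =>
    (if hx : x ∈ (K₀ : Set K) then α₀ ⟨x, hx⟩ else c.lift (α x), ContinuousMap.const I (α x))
  have hf₀K : ∀ x (hx : x ∈ (K₀ : Set K)), (f₀ x).1 = α₀ ⟨x, hx⟩ := fun x hx => dif_pos hx
  have hf₀p : ∀ x, c.proj (f₀ x).1 = α x := by
    intro x
    by_cases hx : x ∈ (K₀ : Set K)
    · rw [hf₀K x hx]; exact hα₀ ⟨x, hx⟩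
    · simp only [f₀, dif_neg hx]; exact c.proj_lift _
  have hf₀c : ContinuousOn f₀ (K₀ : Set K) := by
    refine ContinuousOn.prodMk ?_ (ContinuousMap.continuous_const'.comp α.continuous).continuousOn
    rw [continuousOn_iff_continuous_domRestrict]
    refine α₀.continuous.congr fun x => ?_
    exact (hf₀K x x.2).symm
  have hcell : ∀ {n : ℕ} (e : cell (univ : Set K) n), ∃ a : (Fin n → ℝ) → B, Continuous a ∧
      EqOn a (α ∘ map n e) (closedBall 0 1) := fun e =>
    exists_continuous_eqOn_closedBall
      (α.continuous.comp_continuousOn (RelCWComplex.continuousOn _ e))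
  obtain ⟨f₁, hf₁K, hf₁c, hf₁Q⟩ := exists_extend_cells 1 K₀ f₀ hf₀c
    (by
      intro m hm e
      obtain rfl : m = 0 := by omega
      rw [closedCell_zero_eq_singleton]
      exact continuousOn_singleton _ _)
    (fun x y => y.2 0 = α x ∧ y.2 1 = c.proj y.1 ∧ ∀ t, dist (y.2 t) (α x) < δ / 2)
    (fun x => ⟨rfl, (hf₀p x).symm, fun t => by simpa [f₀] using hδ⟩)
    (fun e he => by
      obtain ⟨a, ha, haα⟩ := hcell e
      obtain ⟨g, hg, hgS, hgB⟩ := c.exists_cell_lift_path one_le_two ha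
        (continuous_fst.comp_continuousOn he)
        (fun u hu => (hf₀p _).trans (haα (sphere_subset_closedBall hu)).symm) (half_pos hδ)
      refine ⟨g, hg, fun u hu => ?_, fun u hu => ?_⟩
      · rw [hgS u hu, haα (sphere_subset_closedBall hu)]
        rfl
      · have := hgB u hu
        rwa [haα hu] at this)
  obtain ⟨f₂, hf₂K, hf₂c, hf₂Q⟩ := exists_extend_cells 2 K₀ (fun x => (f₁ x).1)
    (continuous_fst.comp_continuousOn (hf₀c.congr hf₁K))
    (fun m hm e => continuous_fst.comp_continuousOn (hf₁c m hm e))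
    (fun x y => dist (c.proj y) (α x) < δ)
    (fun x => by
      obtain ⟨-, h1, h2⟩ := hf₁Q x
      rw [← h1]
      exact (h2 1).trans (half_lt_self hδ))
    (fun e _ => by
      obtain ⟨a, ha, haα⟩ := hcell e
      obtain ⟨g, hg, hgS, hgB⟩ := c.exists_cell_lift_of_path le_rfl ha
        (continuousOn_comp_map_sphere hf₁c e) hδ (fun u hu => by
          rw [haα (sphere_subset_closedBall hu)]
          exact hf₁Q _)
      refine ⟨g, hg, hgS, fun u hu => ?_⟩
      have := hgB u hu
      rwa [haα hu] at this)
  refine ⟨⟨f₂, continuous_of_continuousOn_closedCell fun n e => ?_⟩, fun x => ?_, hf₂Q⟩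
  · rcases lt_or_ge n 3 with h | h
    · exact hf₂c n h e
    · exact ((hK n h).false e).elim
  · exact (hf₂K x.2).trans ((congrArg Prod.fst (hf₁K x.2)).trans (hf₀K x x.2))

end Metric

end FiberwiseCollapse

/-- Precomposition with a homeomorphism preserves `UV¹`-maps. -/
theorem IsUVOneMap.comp_homeomorph {X X' B : Type*} [TopologicalSpace X] [TopologicalSpace X']
    [MetricSpace B] {p : X → B} (hp : IsUVOneMap.{u} p) (h : X' ≃ₜ X) :
    IsUVOneMap.{u} (p ∘ h) := by
  refine ⟨hp.1.comp h.continuous, fun δ hδ K _ _ _ hK K₀ α₀ α hα₀ => ?_⟩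
  obtain ⟨αbar, h1, h2⟩ := hp.2 δ hδ K hK K₀ ((h : C(X', X)).comp α₀) α hα₀
  refine ⟨(h.symm : C(X, X')).comp αbar, fun x => ?_, fun x => ?_⟩
  · simp [h1 x]
  · simpa using h2 x

/-! ### The projection of the half-disc from the point `1` -/

/-- The half-disc `{c : 0 ≤ Re c, |c| ≤ 1}`. -/
def halfDisc : Set ℂ := {c | 0 ≤ c.re ∧ ‖c‖ ≤ 1}

theorem isClosed_halfDisc : IsClosed halfDisc :=
  (isClosed_le continuous_const Complex.continuous_re).inter
    (isClosed_le continuous_norm continuous_const)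

theorem convex_halfDisc : Convex ℝ halfDisc := by
  have h : halfDisc = {c : ℂ | 0 ≤ c.re} ∩ closedBall 0 1 := by
    ext c; simp [halfDisc]
  rw [h]
  exact (convex_halfSpace_re_ge 0).inter (convex_closedBall 0 1)

theorem isCompact_halfDisc : IsCompact halfDisc :=
  (isCompact_closedBall (0 : ℂ) 1).of_isClosed_subset isClosed_halfDisc fun _ hc =>
    mem_closedBall_zero_iff.2 hc.2

theorem one_mem_halfDisc : (1 : ℂ) ∈ halfDisc := ⟨by simp, by simp⟩

theorem re_sq_add_im_sq_le {c : ℂ} (h : ‖c‖ ≤ 1) : c.re * c.re + c.im * c.im ≤ 1 := by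
  have := Complex.normSq_eq_norm_sq c
  rw [Complex.normSq_apply] at this
  rw [this]; nlinarith [norm_nonneg c]

theorem re_lt_one {c : ℂ} (h : ‖c‖ ≤ 1) (hc : c ≠ 1) : c.re < 1 := by
  by_contra hre
  apply hc
  have hsq := re_sq_add_im_sq_le h
  have hr : c.re = 1 := by nlinarith [mul_self_nonneg c.im]
  have hi : c.im = 0 := by
    rw [hr] at hsq; nlinarith [mul_self_nonneg c.im]
  exact Complex.ext hr hi

theorem norm_sub_one_sq (c : ℂ) : ‖c - 1‖ ^ 2 = (c.re - 1) * (c.re - 1) + c.im * c.im := by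
  rw [← Complex.normSq_eq_norm_sq, Complex.normSq_apply]; simp

/-- The factor solves `Re = 0` or `|·| = 1` on the ray from 1, and it is at least 1 because `c` has
not yet left the half-disc. -/
theorem exists_halfDiscProj_eq {c : ℂ} (hc : c ∈ halfDisc) (hc1 : c ≠ 1) :
    ∃ l : ℝ, 1 ≤ l ∧ halfDiscProj c = 1 + l * (c - 1) := by
  have hre := re_lt_one hc.2 hc1
  have hpos : 0 < 1 - c.re := by linarith
  by_cases h : |c.im| ≤ 1 - c.re
  · refine ⟨1 / (1 - c.re), (one_le_div hpos).2 (by linarith [hc.1]), ?_⟩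
    rw [halfDiscProj, if_pos h]
    apply Complex.ext
    · simp only [Complex.re_ofReal_mul, Complex.I_re, mul_zero, Complex.add_re, Complex.one_re,
        Complex.sub_re]
      field_simp; ring
    · simp only [Complex.im_ofReal_mul, Complex.I_im, mul_one, Complex.add_im, Complex.one_im,
        Complex.sub_im]
      field_simp; ring
  · have hne : c - 1 ≠ 0 := sub_ne_zero.2 hc1
    have hn : 0 < Complex.normSq (c - 1) := Complex.normSq_pos.2 hne
    have hns : Complex.normSq (c - 1) = (c.re - 1) * (c.re - 1) + c.im * c.im := by
      rw [Complex.normSq_apply]; simp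
    refine ⟨2 * (1 - c.re) / Complex.normSq (c - 1), (one_le_div hn).2 ?_, ?_⟩
    · rw [hns]
      nlinarith [re_sq_add_im_sq_le hc.2]
    · rw [halfDiscProj, if_neg h]
      have hconj : (starRingEnd ℂ) (c - 1) ≠ 0 := (map_ne_zero _).2 hne
      rw [div_eq_iff hconj, add_mul, mul_assoc, Complex.mul_conj, ← Complex.ofReal_mul,
        div_mul_cancel₀ _ hn.ne']
      apply Complex.ext
      · simp; ring
      · simp

/-- Both the case distinction and the two formulas are homogeneous of degree 0 in `c - 1`. This is
what makes the flow and the legs stay in fibres. -/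
theorem halfDiscProj_one_add_mul {l : ℝ} (hl : 0 < l) (c : ℂ) :
    halfDiscProj (1 + l * (c - 1)) = halfDiscProj c := by
  have him : (1 + (l : ℂ) * (c - 1)).im = l * c.im := by simp
  have hre : 1 - (1 + (l : ℂ) * (c - 1)).re = l * (1 - c.re) := by simp; ring
  have hsub : 1 + (l : ℂ) * (c - 1) - 1 = l * (c - 1) := by ring
  have hiff : l * |c.im| ≤ l * (1 - c.re) ↔ |c.im| ≤ 1 - c.re := mul_le_mul_iff_right₀ hl
  rw [halfDiscProj, halfDiscProj, him, hre, hsub, abs_mul, abs_of_pos hl]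
  simp only [hiff]
  rw [mul_div_mul_left _ _ hl.ne', map_mul, Complex.conj_ofReal, ← mul_neg,
    mul_div_mul_left _ _ (Complex.ofReal_ne_zero.2 hl.ne')]

theorem halfDiscProj_of_re_eq_zero {c : ℂ} (h : c.re = 0) (h1 : ‖c‖ ≤ 1) : halfDiscProj c = c := by
  rw [halfDiscProj, if_pos (by
    rw [h, sub_zero]; exact (Complex.abs_im_le_norm c).trans h1), h, sub_zero, div_one]
  apply Complex.ext <;> simp [h]

theorem halfDiscProj_of_norm_eq_one {c : ℂ} (h : 0 ≤ c.re) (h1 : ‖c‖ = 1) (hc : c ≠ 1) :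
    halfDiscProj c = c := by
  by_cases hi : |c.im| ≤ 1 - c.re
  · refine halfDiscProj_of_re_eq_zero ?_ h1.le
    have hre := re_lt_one h1.le hc
    have hsq : c.re * c.re + c.im * c.im = 1 := by
      rw [← Complex.normSq_apply, Complex.normSq_eq_norm_sq, h1]; norm_num
    have : c.im * c.im ≤ (1 - c.re) * (1 - c.re) := by
      rw [← abs_mul_abs_self c.im]
      exact mul_self_le_mul_self (abs_nonneg _) hi
    -- On the circle the inequality becomes `Re c * (1 - Re c) ≤ 0`, so only `±i` fall into this
    -- case.
    nlinarith
  · rw [halfDiscProj, if_neg hi]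
    have hconj : (starRingEnd ℂ) (c - 1) ≠ 0 := (map_ne_zero _).2 (sub_ne_zero.2 hc)
    rw [div_eq_iff hconj, map_sub, map_one, mul_sub, Complex.mul_conj, Complex.normSq_eq_norm_sq, h1]
    push_cast; ring

/-- The two formulas meet on the rays `|Im c| = 1 - Re c`, which leave through the corners `±i`. -/
theorem continuousOn_halfDiscProj : ContinuousOn halfDiscProj (halfDisc ∩ {c | c ≠ 1}) := by
  rw [continuousOn_iff_continuous_domRestrict]
  have hval : Continuous fun c : ↥(halfDisc ∩ {c | c ≠ 1}) => (c : ℂ) := continuous_subtype_val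
  have hre : Continuous fun c : ↥(halfDisc ∩ {c | c ≠ 1}) => (c : ℂ).re :=
    Complex.continuous_re.comp hval
  have him : Continuous fun c : ↥(halfDisc ∩ {c | c ≠ 1}) => (c : ℂ).im :=
    Complex.continuous_im.comp hval
  have hlt : ∀ c : ↥(halfDisc ∩ {c | c ≠ 1}), 0 < 1 - (c : ℂ).re := fun c =>
    sub_pos.2 (re_lt_one c.2.1.2 c.2.2)
  refine Continuous.if_le (f := fun c : ↥(halfDisc ∩ {c | c ≠ 1}) => |(c : ℂ).im|)
    (g := fun c => 1 - (c : ℂ).re) ?_ ?_ him.abs (continuous_const.sub hre) ?_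
  · exact (Complex.continuous_ofReal.comp (him.div (continuous_const.sub hre)
      fun c => (hlt c).ne')).mul continuous_const
  · refine Continuous.div (hval.sub continuous_const).neg
      (Complex.continuous_conj.comp (hval.sub continuous_const)) fun c => ?_
    exact (map_ne_zero _).2 (sub_ne_zero.2 c.2.2)
  · intro c hc
    have h0 := hlt c
    have hconj : (starRingEnd ℂ) ((c : ℂ) - 1) ≠ 0 := (map_ne_zero _).2 (sub_ne_zero.2 c.2.2)
    rw [eq_div_iff hconj]
    rcases abs_eq_abs.1 (hc.trans (abs_of_pos h0).symm) with h | h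
    · rw [h, div_self h0.ne']
      apply Complex.ext
      · simp [h]
      · simp [h]
    · rw [h, neg_div, div_self h0.ne']
      apply Complex.ext
      · simp [h]
      · simp [h]

/-- The straight-line homotopy from the identity to `halfDiscProj`. -/
def halfDiscRay (t : ℝ) (c : ℂ) : ℂ := (1 - t : ℝ) • c + t • halfDiscProj c

theorem halfDiscRay_zero (c : ℂ) : halfDiscRay 0 c = c := by simp [halfDiscRay]

theorem halfDiscRay_one (c : ℂ) : halfDiscRay 1 c = halfDiscProj c := by simp [halfDiscRay]

theorem halfDiscRay_of_fixed {c : ℂ} (t : ℝ) (h : halfDiscProj c = c) : halfDiscRay t c = c := by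
  rw [halfDiscRay, h, ← add_smul, sub_add_cancel, one_smul]

theorem halfDiscProj_mem {c : ℂ} (hc : c ∈ halfDisc) (hc1 : c ≠ 1) : halfDiscProj c ∈ halfDisc := by
  rcases halfDiscProj_spec hc.1 hc.2 hc1 with ⟨h, h'⟩ | ⟨h, h', -⟩
  · exact ⟨h.ge, h'⟩
  · exact ⟨h'.le, h.le⟩

theorem halfDiscRay_mem {c : ℂ} (hc : c ∈ halfDisc) (hc1 : c ≠ 1) (t : I) :
    halfDiscRay t c ∈ halfDisc :=
  convex_halfDisc hc (halfDiscProj_mem hc hc1) (sub_nonneg.2 t.2.2) t.2.1 (sub_add_cancel _ _)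

theorem exists_halfDiscRay_eq {c : ℂ} (hc : c ∈ halfDisc) (hc1 : c ≠ 1) (t : I) :
    ∃ l : ℝ, 1 ≤ l ∧ halfDiscRay t c = 1 + l * (c - 1) := by
  obtain ⟨l, hl, h⟩ := exists_halfDiscProj_eq hc hc1
  refine ⟨1 - t + t * l, ?_, ?_⟩
  · nlinarith [t.2.1]
  · rw [halfDiscRay, h, Complex.real_smul, Complex.real_smul]
    push_cast; ring

theorem halfDiscProj_halfDiscRay {c : ℂ} (hc : c ∈ halfDisc) (hc1 : c ≠ 1) (t : I) :
    halfDiscProj (halfDiscRay t c) = halfDiscProj c := by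
  obtain ⟨l, hl, h⟩ := exists_halfDiscRay_eq hc hc1 t
  rw [h, halfDiscProj_one_add_mul (by linarith)]

theorem norm_sub_one_le_halfDiscRay {c : ℂ} (hc : c ∈ halfDisc) (hc1 : c ≠ 1) (t : I) :
    ‖c - 1‖ ≤ ‖halfDiscRay t c - 1‖ := by
  obtain ⟨l, hl, h⟩ := exists_halfDiscRay_eq hc hc1 t
  rw [h, add_sub_cancel_left, norm_mul, Complex.norm_real, Real.norm_eq_abs,
    abs_of_pos (by linarith)]
  nlinarith [norm_nonneg (c - 1)]

/-! ### Sectors of a meridian disc -/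

/-- The inverse of the half-disc coordinate on the sector with centre `1`. -/
def wedge (m : ℤ) (c : ℂ) : ℂ := (‖c‖ : ℂ) * Complex.exp ((2 * c.arg / m : ℝ) * Complex.I)

theorem norm_wedge (m : ℤ) (c : ℂ) : ‖wedge m c‖ = ‖c‖ := by
  rw [wedge, norm_mul, Complex.norm_exp_ofReal_mul_I, Complex.norm_real, norm_norm, mul_one]

theorem wedge_zero (m : ℤ) : wedge m 0 = 0 := by simp [wedge]

/-- The half-disc avoids the cut of `arg` except at 0, where the modulus controls everything. -/
theorem continuousOn_wedge (m : ℤ) : ContinuousOn (wedge m) halfDisc := by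
  intro c hc
  refine ContinuousAt.continuousWithinAt ?_
  by_cases h0 : c = 0
  · subst h0
    have h : Filter.Tendsto (wedge m) (𝓝 0) (𝓝 0) :=
      squeeze_zero_norm (fun c => (norm_wedge m c).le) tendsto_norm_zero
    simpa [ContinuousAt, wedge_zero] using h
  · have hs : c ∈ Complex.slitPlane := by
      rw [Complex.mem_slitPlane_iff]
      by_contra! h
      exact h0 (Complex.ext (le_antisymm h.1 hc.1) h.2)
    have harg : ContinuousAt Complex.arg c := Complex.continuousAt_arg hs
    have hn : ContinuousAt (fun c : ℂ => (‖c‖ : ℂ)) c :=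
      (Complex.continuous_ofReal.comp continuous_norm).continuousAt
    refine hn.mul (Complex.continuous_exp.continuousAt.comp (ContinuousAt.mul ?_ continuousAt_const))
    exact Complex.continuous_ofReal.continuousAt.comp
      ((continuousAt_const.mul harg).div_const _)

theorem wedge_zpow {m : ℤ} (hm : m ≠ 0) (c : ℂ) :
    wedge m c ^ m = ((‖c‖ ^ m : ℝ) : ℂ) * Complex.exp ((2 * c.arg : ℝ) * Complex.I) := by
  have hmC : (m : ℂ) ≠ 0 := Int.cast_ne_zero.2 hm
  rw [wedge, mul_zpow, ← Complex.exp_int_mul]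
  congr 2
  · push_cast; rfl
  · push_cast; field_simp

/-- Doubling sends `arg c` into `[-π, π]`, and only the end `-π` is renormalized by `arg`, to `π`.
So the coordinate is recovered except on the lower half of the diameter, which is read as the upper
half. -/
theorem sectorCoord_wedge {m n : ℤ} (hm : m ≠ 0) {u v : Circle} (huv : u ^ m = v ^ n) {c : ℂ}
    (hc : c ∈ halfDisc) : sectorCoord m n (u * wedge m c) v = c ∨
      (c.re = 0 ∧ sectorCoord m n (u * wedge m c) v = -c) := by
  by_cases h0 : c = 0
  · subst h0
    left
    simp [wedge_zero, sectorCoord]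
  have hpos : 0 < ‖c‖ ^ m := zpow_pos (norm_pos_iff.2 h0) m
  have huv' : (u : ℂ) ^ m * (v : ℂ) ^ (-n) = 1 := by
    rw [← Circle.coe_zpow, ← Circle.coe_zpow, huv, ← Circle.coe_mul, ← zpow_add, add_neg_cancel,
      zpow_zero, Circle.coe_one]
  have hz : (u * wedge m c) ^ m * (v : ℂ) ^ (-n) =
      ((‖c‖ ^ m : ℝ) : ℂ) * Complex.exp ((2 * c.arg : ℝ) * Complex.I) := by
    rw [mul_zpow, mul_right_comm, huv', one_mul, wedge_zpow hm]
  have hnorm : ‖(u : ℂ) * wedge m c‖ = ‖c‖ := by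
    rw [norm_mul, Circle.norm_coe, one_mul, norm_wedge]
  have habs := abs_le.1 (Complex.abs_arg_le_pi_div_two_iff.2 hc.1)
  have hpolar := Complex.norm_mul_exp_arg_mul_I c
  rw [sectorCoord, hz, hnorm]
  by_cases harg : c.arg = -(Real.pi / 2)
  · right
    have e1 : Complex.exp ((2 * c.arg : ℝ) * Complex.I) =
        Complex.cos (Real.pi : ℝ) + Complex.sin (Real.pi : ℝ) * Complex.I := by
      rw [← Complex.exp_mul_I, Complex.exp_pi_mul_I, harg,
        show 2 * -(Real.pi / 2) = -Real.pi by ring, Complex.ofReal_neg, neg_mul, Complex.exp_neg,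
        Complex.exp_pi_mul_I]
      norm_num
    rw [e1, Complex.arg_mul_cos_add_sin_mul_I hpos ⟨by linarith [Real.pi_pos], le_rfl⟩]
    have e2 : Complex.exp ((Real.pi / 2 : ℝ) * Complex.I) = Complex.I := by
      push_cast; exact Complex.exp_pi_div_two_mul_I
    have e3 : c = -(‖c‖ * Complex.I) := by
      rw [harg, Complex.ofReal_neg, neg_mul, Complex.exp_neg, e2, Complex.inv_I] at hpolar
      rw [← mul_neg]; exact hpolar.symm
    rw [e2]
    constructor
    · rw [e3]; simp
    · nth_rewrite 2 [e3]
      rw [neg_neg]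
  · left
    have hlt : -(Real.pi / 2) < c.arg := lt_of_le_of_ne habs.1 (Ne.symm harg)
    rw [Complex.exp_mul_I ((2 * c.arg : ℝ) : ℂ), Complex.arg_mul_cos_add_sin_mul_I hpos
      ⟨by linarith, by linarith [habs.2]⟩, mul_div_cancel_left₀ _ two_ne_zero]
    exact hpolar

theorem norm_sectorCoord_wedge_sub_one {m n : ℤ} (hm : m ≠ 0) {u v : Circle} (huv : u ^ m = v ^ n)
    {c : ℂ} (hc : c ∈ halfDisc) : ‖sectorCoord m n (u * wedge m c) v - 1‖ = ‖c - 1‖ := by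
  rcases sectorCoord_wedge hm huv hc with h | ⟨h, h'⟩
  · rw [h]
  · rw [h', ← sq_eq_sq₀ (norm_nonneg _) (norm_nonneg _), norm_sub_one_sq, norm_sub_one_sq]
    simp [h]

/-- Every point of a meridian disc lies in a sector. -/
theorem exists_wedge_eq {m : ℤ} (n : ℤ) (hm : m ≠ 0) {z : ℂ} (hz : ‖z‖ ≤ 1) (v : Circle) :
    ∃ c ∈ halfDisc, ∃ u : Circle, u ^ m = v ^ n ∧ (u : ℂ) * wedge m c = z := by
  have hmR : (m : ℝ) ≠ 0 := Int.cast_ne_zero.2 hm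
  refine ⟨sectorCoord m n z v, ⟨re_sectorCoord_nonneg m n z v, (norm_sectorCoord m n z v).trans_le
    hz⟩, ?_⟩
  by_cases h0 : z = 0
  · subst h0
    refine ⟨Circle.exp (n * (v : ℂ).arg / m), ?_, by simp [sectorCoord, wedge_zero]⟩
    rw [← Circle.exp_intCast_mul, mul_div_cancel₀ _ hmR, Circle.exp_intCast_mul]
    congr 1
    ext
    have := Complex.norm_mul_exp_arg_mul_I (v : ℂ)
    rwa [Circle.norm_coe, Complex.ofReal_one, one_mul] at this
  · have hn : ‖z‖ ≠ 0 := norm_ne_zero_iff.2 h0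
    set τ := (z ^ m * (v : ℂ) ^ (-n)).arg with hτ
    have harg : (sectorCoord m n z v).arg = τ / 2 := arg_sectorCoord m n v h0
    have hz' : (‖z‖ : ℂ) * Complex.exp (z.arg * Complex.I) = z := Complex.norm_mul_exp_arg_mul_I z
    -- The coordinate has argument `τ/2`, so `wedge` rotates by `τ/m`; the centre is `z/|z|` rotated
    -- back by this angle.
    refine ⟨Circle.exp (z.arg - τ / m), ?_, ?_⟩
    · have hs := Complex.norm_mul_exp_arg_mul_I (z ^ m * (v : ℂ) ^ (-n))
      have hns : ‖z ^ m * (v : ℂ) ^ (-n)‖ = ‖z‖ ^ m := by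
        simp [norm_zpow, Circle.norm_coe]
      have h1 : Circle.exp τ = Circle.exp z.arg ^ m * v ^ (-n) := by
        ext
        have hne : ((‖z‖ ^ m : ℝ) : ℂ) ≠ 0 := Complex.ofReal_ne_zero.2 (zpow_ne_zero _ hn)
        apply mul_left_cancel₀ hne
        rw [hns] at hs
        rw [Circle.coe_exp, hs, Circle.coe_mul, Circle.coe_zpow, Circle.coe_zpow, Circle.coe_exp,
          ← mul_assoc, Complex.ofReal_zpow, ← mul_zpow, hz']
      rw [← Circle.exp_intCast_mul, mul_sub, mul_div_cancel₀ _ hmR, Circle.exp_sub,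
        Circle.exp_intCast_mul, h1]
      simp
    · rw [wedge, harg, norm_sectorCoord, Circle.coe_exp, mul_left_comm, ← Complex.exp_add]
      refine Eq.trans ?_ hz'
      congr 2
      push_cast; ring

/-- The straight-line homotopy `halfDiscRay` in each sector of a meridian disc. -/
def discFlow (m n : ℤ) (t : ℝ) (u v : ℂ) : ℂ :=
  let c := sectorCoord m n u v
  let c' := halfDiscRay t c
  u / (‖u‖ : ℂ) * ((‖c'‖ : ℂ) * Complex.exp ((2 * (c'.arg - c.arg) / m : ℝ) * Complex.I))

theorem discFlow_one (m n : ℤ) (u v : ℂ) : discFlow m n 1 u v = discCollapse m n u v := by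
  simp only [discFlow, discCollapse, halfDiscRay_one]

theorem discFlow_of_fixed {m n : ℤ} (t : ℝ) {u v : ℂ}
    (h : halfDiscProj (sectorCoord m n u v) = sectorCoord m n u v) : discFlow m n t u v = u := by
  simp only [discFlow, halfDiscRay_of_fixed t h, norm_sectorCoord, sub_self, mul_zero, zero_div,
    Complex.ofReal_zero, zero_mul, Complex.exp_zero, mul_one]
  by_cases hu : u = 0
  · simp [hu]
  · rw [div_mul_cancel₀ _ (Complex.ofReal_ne_zero.2 (norm_ne_zero_iff.2 hu))]

/-- The ambiguity between `c` and `-c` is harmless, since the flow fixes the diameter. -/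
theorem discFlow_wedge {m n : ℤ} (hm : m ≠ 0) {u v : Circle} (huv : u ^ m = v ^ n) {c : ℂ}
    (hc : c ∈ halfDisc) (t : ℝ) :
    discFlow m n t (u * wedge m c) v = u * wedge m (halfDiscRay t c) := by
  by_cases h0 : c = 0
  · subst h0
    rw [halfDiscRay_of_fixed t (halfDiscProj_of_re_eq_zero (by simp) (by simp)), wedge_zero, mul_zero]
    simp [discFlow]
  rcases sectorCoord_wedge hm huv hc with h | ⟨h, h'⟩
  · have hn : (‖c‖ : ℂ) ≠ 0 := Complex.ofReal_ne_zero.2 (norm_ne_zero_iff.2 h0)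
    simp only [discFlow]
    rw [h, norm_mul, Circle.norm_coe, one_mul, norm_wedge, wedge, wedge]
    set c' := halfDiscRay t c
    have e : ((2 * c'.arg / m : ℝ) : ℂ) * Complex.I = (2 * c.arg / m : ℝ) * Complex.I +
        (2 * (c'.arg - c.arg) / m : ℝ) * Complex.I := by
      push_cast; ring
    rw [e, Complex.exp_add]
    field_simp
  · rw [halfDiscRay_of_fixed t (halfDiscProj_of_re_eq_zero h hc.2), discFlow_of_fixed]
    rw [h']
    exact halfDiscProj_of_re_eq_zero (by simp [h]) (by rw [norm_neg]; exact hc.2)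

/-! ### Sectors of the meridian discs of the two solid tori -/

/-- The centres of the sectors of the meridian discs of the two solid tori. -/
abbrev Centers (a b : ℤ) : Type :=
  {q : Circle × Circle // q.1 ^ a = q.2 ^ b} ⊕ {q : Circle × Circle // q.1 ^ b = q.2 ^ a}

instance compactSpace_center (a b : ℤ) : CompactSpace {q : Circle × Circle // q.1 ^ a = q.2 ^ b} :=
  isCompact_iff_compactSpace.1 (isClosed_eq (continuous_fst.zpow a) (continuous_snd.zpow b)).isCompact

/-- The point with half-disc coordinate `c` of the sector with a given centre. -/
def sectorPoint (a b : ℤ) (c : ℂ) : Centers a b → ℂ × ℂ :=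
  Sum.elim (fun q => (q.1.1 * wedge a c, q.1.2)) (fun q => (q.1.2, q.1.1 * wedge b c))

variable {a b : ℤ}

theorem sectorPoint_mem {c : ℂ} (hc : c ∈ halfDisc) (q : Centers a b) :
    sectorPoint a b c q ∈ sphere (0 : ℂ × ℂ) 1 := by
  rcases q with q | q
  · refine mem_S3.2 ?_
    rw [norm_mul, Circle.norm_coe, Circle.norm_coe, norm_wedge, one_mul]
    exact max_eq_right hc.2
  · refine mem_S3.2 ?_
    rw [norm_mul, Circle.norm_coe, Circle.norm_coe, norm_wedge, one_mul]
    exact max_eq_left hc.2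

/-- `sectorPoint` as a map to the sphere. -/
def spherePoint (p : ↥halfDisc × Centers a b) : S3 :=
  ⟨sectorPoint a b p.1 p.2, sectorPoint_mem p.1.2 p.2⟩

theorem continuous_spherePoint : Continuous (spherePoint : ↥halfDisc × Centers a b → S3) := by
  refine Continuous.subtype_mk ?_ _
  rw [← (Homeomorph.prodSumDistrib).symm.comp_continuous_iff', continuous_sum_dom]
  have hw : ∀ m : ℤ, Continuous fun c : ↥halfDisc => wedge m c := fun m =>
    continuousOn_iff_continuous_domRestrict.1 (continuousOn_wedge m)
  constructor
  · change Continuous fun p : ↥halfDisc × {q : Circle × Circle // q.1 ^ a = q.2 ^ b} =>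
      ((p.2.1.1 : ℂ) * wedge a p.1, (p.2.1.2 : ℂ))
    have := (hw a).comp (continuous_fst (X := ↥halfDisc)
      (Y := {q : Circle × Circle // q.1 ^ a = q.2 ^ b}))
    fun_prop
  · change Continuous fun p : ↥halfDisc × {q : Circle × Circle // q.1 ^ b = q.2 ^ a} =>
      ((p.2.1.2 : ℂ), (p.2.1.1 : ℂ) * wedge b p.1)
    have := (hw b).comp (continuous_fst (X := ↥halfDisc)
      (Y := {q : Circle × Circle // q.1 ^ b = q.2 ^ a}))
    fun_prop

theorem surjective_spherePoint (ha : a ≠ 0) (hb : b ≠ 0) :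
    Function.Surjective (spherePoint : ↥halfDisc × Centers a b → S3) := by
  intro x
  obtain ⟨hz, hw, hzw⟩ := norm_of_S3 x
  by_cases h : ‖x.1.2‖ = 1
  · obtain ⟨c, hc, u, hu, e⟩ := exists_wedge_eq b ha hz ⟨x.1.2, mem_sphere_zero_iff_norm.2 h⟩
    exact ⟨(⟨c, hc⟩, Sum.inl ⟨(u, _), hu⟩), Subtype.ext (Prod.ext e rfl)⟩
  · obtain ⟨c, hc, u, hu, e⟩ := exists_wedge_eq a hb hw ⟨x.1.1, mem_sphere_zero_iff_norm.2 (hzw h)⟩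
    exact ⟨(⟨c, hc⟩, Sum.inr ⟨(u, _), hu⟩), Subtype.ext (Prod.ext rfl e)⟩

/-- A sector of `T*` reaches the common torus, where `coord` switches to the side of `T`; the
distance to 1 is the same from both sides. -/
theorem norm_coord_spherePoint_sub_one (ha : a ≠ 0) (hb : b ≠ 0) (p : ↥halfDisc × Centers a b) :
    ‖coord a b (spherePoint p) - 1‖ = ‖(p.1 : ℂ) - 1‖ := by
  obtain ⟨c, q | q⟩ := p
  · have h : ‖(spherePoint (c, Sum.inl q) : S3).1.2‖ = 1 := Circle.norm_coe q.1.2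
    rw [coord, if_pos h]
    exact norm_sectorCoord_wedge_sub_one ha q.2 c.2
  · have h : ‖(spherePoint (c, Sum.inr q) : S3).1.1‖ = 1 := Circle.norm_coe q.1.2
    have hs : ‖sectorCoord b a (spherePoint (c, Sum.inr q) : S3).1.2
        (spherePoint (c, Sum.inr q) : S3).1.1 - 1‖ = ‖(c : ℂ) - 1‖ :=
      norm_sectorCoord_wedge_sub_one hb q.2 c.2
    rw [coord]
    split_ifs with h'
    · rw [norm_sectorCoord_sub_one_symm h h', hs]
    · exact hs

/-- The straight-line homotopy in each sector from the identity to the collapse. -/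
def flowFun (a b : ℤ) (t : ℝ) (x : S3) : ℂ × ℂ :=
  if ‖x.1.2‖ = 1 then (discFlow a b t x.1.1 x.1.2, x.1.2)
  else (x.1.1, discFlow b a t x.1.2 x.1.1)

theorem flowFun_one (x : S3) : flowFun a b 1 x = collapseFun a b x := by
  simp only [flowFun, collapseFun, discFlow_one]

theorem flowFun_spherePoint (ha : a ≠ 0) (hb : b ≠ 0) (p : ↥halfDisc × Centers a b)
    (hp : (p.1 : ℂ) ≠ 1) (t : ℝ) :
    flowFun a b t (spherePoint p) = sectorPoint a b (halfDiscRay t p.1) p.2 := by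
  obtain ⟨c, q | q⟩ := p
  · have h : ‖(spherePoint (c, Sum.inl q) : S3).1.2‖ = 1 := Circle.norm_coe q.1.2
    rw [flowFun, if_pos h]
    exact Prod.ext (discFlow_wedge ha q.2 c.2 t) rfl
  · have h : ‖(spherePoint (c, Sum.inr q) : S3).1.1‖ = 1 := Circle.norm_coe q.1.2
    rw [flowFun]
    split_ifs with h'
    -- A point of `T*` on the common torus is treated by the formula for `T`. Both formulas fix it,
    -- since its coordinate lies on the arc and is not 1.
    · have hc : ‖(c : ℂ)‖ = 1 := by
        have : ‖(q.1.1 : ℂ) * wedge b c‖ = 1 := h'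
        rwa [norm_mul, Circle.norm_coe, one_mul, norm_wedge] at this
      have hs : ‖sectorCoord b a (spherePoint (c, Sum.inr q) : S3).1.2
          (spherePoint (c, Sum.inr q) : S3).1.1 - 1‖ = ‖(c : ℂ) - 1‖ :=
        norm_sectorCoord_wedge_sub_one hb q.2 c.2
      rw [discFlow_of_fixed]
      · rw [halfDiscRay_of_fixed t (halfDiscProj_of_norm_eq_one c.2.1 hc hp)]
        rfl
      · refine halfDiscProj_of_norm_eq_one (re_sectorCoord_nonneg _ _ _ _)
          ((norm_sectorCoord _ _ _ _).trans h) fun h1 => hp ?_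
        rw [← norm_sectorCoord_sub_one_symm h h', h1, sub_self, norm_zero] at hs
        exact sub_eq_zero.1 (norm_eq_zero.1 hs.symm)
    · exact Prod.ext rfl (discFlow_wedge hb q.2 c.2 t)

/-! ### The knot complement as a quotient of a family of truncated half-discs -/

/-- The half-disc without the disc of radius `ε` about `1`. -/
abbrev TruncatedHalfDisc (ε : ℝ) : Type := {c : ↥halfDisc // ε ≤ ‖(c : ℂ) - 1‖}

instance compactSpace_truncatedHalfDisc (ε : ℝ) : CompactSpace (TruncatedHalfDisc ε) := by
  have : CompactSpace ↥halfDisc := isCompact_iff_compactSpace.1 isCompact_halfDisc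
  refine isCompact_iff_compactSpace.1 (IsClosed.isCompact ?_)
  exact isClosed_le continuous_const (continuous_subtype_val.sub continuous_const).norm

variable {ε : ℝ}

theorem TruncatedHalfDisc.ne_one (hε : 0 < ε) (c : TruncatedHalfDisc ε) : (c.1 : ℂ) ≠ 1 := fun h => by
  have := c.2
  rw [h, sub_self, norm_zero] at this
  linarith

/-- The parametrization of the knot complement by truncated half-discs. -/
def complementPoint (ha : a ≠ 0) (hb : b ≠ 0) (p : TruncatedHalfDisc ε × Centers a b) :
    ↥(knotComplement a b ε) :=
  ⟨spherePoint (p.1.1, p.2), mem_knotComplement.2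
    (by rw [norm_coord_spherePoint_sub_one ha hb]; exact p.1.2)⟩

theorem continuous_complementPoint (ha : a ≠ 0) (hb : b ≠ 0) :
    Continuous (complementPoint ha hb : TruncatedHalfDisc ε × Centers a b → _) :=
  (continuous_spherePoint.comp ((continuous_subtype_val.comp continuous_fst).prodMk
    continuous_snd)).subtype_mk _

theorem surjective_complementPoint (ha : a ≠ 0) (hb : b ≠ 0) :
    Function.Surjective (complementPoint ha hb : TruncatedHalfDisc ε × Centers a b → _) := by
  rintro ⟨x, hx⟩
  obtain ⟨⟨c, q⟩, rfl⟩ := surjective_spherePoint ha hb x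
  have := mem_knotComplement.1 hx
  rw [norm_coord_spherePoint_sub_one ha hb] at this
  exact ⟨(⟨c, this⟩, q), rfl⟩

/-- `halfDiscRay` on the truncated half-disc. -/
def truncatedRay (hε : 0 < ε) (p : I × TruncatedHalfDisc ε) : TruncatedHalfDisc ε :=
  ⟨⟨halfDiscRay p.1 p.2.1, halfDiscRay_mem p.2.1.2 (p.2.ne_one hε) p.1⟩,
    p.2.2.trans (norm_sub_one_le_halfDiscRay p.2.1.2 (p.2.ne_one hε) p.1)⟩

theorem continuous_truncatedRay (hε : 0 < ε) : Continuous (truncatedRay hε) := by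
  refine Continuous.subtype_mk (Continuous.subtype_mk ?_ _) _
  have h1 : Continuous fun p : I × TruncatedHalfDisc ε => (p.2.1 : ℂ) :=
    continuous_subtype_val.comp (continuous_subtype_val.comp continuous_snd)
  have h2 : Continuous fun p : I × TruncatedHalfDisc ε => halfDiscProj p.2.1 :=
    continuousOn_halfDiscProj.comp_continuous h1 fun p => ⟨p.2.1.2, p.2.ne_one hε⟩
  have h3 : Continuous fun p : I × TruncatedHalfDisc ε => (p.1 : ℝ) :=
    continuous_subtype_val.comp continuous_fst
  exact ((continuous_const.sub h3).smul h1).add (h3.smul h2)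

/-- The flow on the knot complement from the identity to the collapse. -/
def complementFlow (ha : a ≠ 0) (hb : b ≠ 0) (hε : 0 < ε) (p : I × ↥(knotComplement a b ε)) :
    ↥(knotComplement a b ε) :=
  let q := Function.surjInv (surjective_complementPoint ha hb) p.2
  complementPoint ha hb (truncatedRay hε (p.1, q.1), q.2)

/-- The parameter chosen by `surjInv` does not matter: the flowed point is given by a formula in `x`
alone. -/
theorem complementFlow_val (ha : a ≠ 0) (hb : b ≠ 0) (hε : 0 < ε) (t : I)
    (x : ↥(knotComplement a b ε)) : (complementFlow ha hb hε (t, x)).1.1 = flowFun a b t x := by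
  have h := Function.surjInv_eq (surjective_complementPoint ha hb) x
  rw [complementFlow]
  set q := Function.surjInv (surjective_complementPoint ha hb) x
  rw [← h]
  exact (flowFun_spherePoint ha hb (q.1.1, q.2) (q.1.ne_one hε) t).symm

theorem complementFlow_complementPoint (ha : a ≠ 0) (hb : b ≠ 0) (hε : 0 < ε) (t : I)
    (p : TruncatedHalfDisc ε × Centers a b) :
    complementFlow ha hb hε (t, complementPoint ha hb p) =
      complementPoint ha hb (truncatedRay hε (t, p.1), p.2) := by
  refine Subtype.ext (Subtype.ext ?_)
  rw [complementFlow_val]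
  exact flowFun_spherePoint ha hb (p.1.1, p.2) (p.1.ne_one hε) t

theorem continuous_complementFlow (ha : a ≠ 0) (hb : b ≠ 0) (hε : 0 < ε) :
    Continuous (complementFlow ha hb hε : I × ↥(knotComplement a b ε) → _) := by
  let f : I × (TruncatedHalfDisc ε × Centers a b) → I × ↥(knotComplement a b ε) :=
    Prod.map id (complementPoint ha hb)
  -- A continuous surjection from a compact space to a Hausdorff space is a quotient map, so
  -- continuity may be tested on the half-discs.
  have hf : IsQuotientMap f := IsQuotientMap.of_surjective_continuous
    (Function.surjective_id.prodMap (surjective_complementPoint ha hb))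
    (continuous_id.prodMap (continuous_complementPoint ha hb))
  rw [hf.continuous_iff]
  have h : complementFlow ha hb hε ∘ f = fun p =>
      complementPoint ha hb (truncatedRay hε (p.1, p.2.1), p.2.2) := by
    funext p
    exact complementFlow_complementPoint ha hb hε p.1 p.2
  rw [h]
  exact (continuous_complementPoint ha hb).comp (((continuous_truncatedRay hε).comp
    (continuous_fst.prodMk (continuous_fst.comp continuous_snd))).prodMk
    (continuous_snd.comp continuous_snd))

theorem truncatedRay_truncatedRay (hε : 0 < ε) (t : I) (c : TruncatedHalfDisc ε) :
    truncatedRay hε (1, truncatedRay hε (t, c)) = truncatedRay hε (1, c) := by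
  refine Subtype.ext (Subtype.ext ?_)
  change halfDiscRay ((1 : I) : ℝ) (halfDiscRay t c.1) = halfDiscRay ((1 : I) : ℝ) c.1
  rw [Set.Icc.coe_one, halfDiscRay_one, halfDiscRay_one,
    halfDiscProj_halfDiscRay c.1.2 (c.ne_one hε)]

/-- The collapse fixes the spine. -/
theorem collapseFun_of_mem_spine (hε : 0 < ε) {x : S3} (hx : x ∈ spine a b ε) :
    collapseFun a b x = x.1 := by
  obtain ⟨hxM, hx⟩ := hx
  have hc := coord_ne_one hε hxM
  obtain ⟨hz, hw, hzw⟩ := norm_of_S3 x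
  rw [← flowFun_one, flowFun]
  rw [coord] at hc
  split_ifs at hc ⊢ with h
  · rw [discFlow_of_fixed]
    rcases hx with ⟨h1, -⟩ | ⟨h1, h2⟩
    · exact halfDiscProj_of_norm_eq_one (re_sectorCoord_nonneg _ _ _ _)
        ((norm_sectorCoord _ _ _ _).trans h1) hc
    · refine halfDiscProj_of_re_eq_zero (re_sectorCoord_eq_zero (fun h0 => ?_) h1 h2)
        ((norm_sectorCoord _ _ _ _).trans_le hz)
      simp [h0] at h
  · have h1 := hzw h
    rw [discFlow_of_fixed]
    rcases hx with ⟨-, h2⟩ | ⟨h2, h3⟩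
    · exact absurd h2 h
    · have hinv : x.1.2 ^ b * x.1.1 ^ (-a) = (x.1.1 ^ a * x.1.2 ^ (-b))⁻¹ := by
        rw [zpow_neg, zpow_neg, mul_inv, inv_inv, mul_comm]
      refine halfDiscProj_of_re_eq_zero (re_sectorCoord_eq_zero (fun h0 => ?_) ?_ ?_)
        ((norm_sectorCoord _ _ _ _).trans_le hw)
      · simp [h0] at h1
      · rw [hinv, Complex.inv_re]
        exact div_nonpos_of_nonpos_of_nonneg h2 (Complex.normSq_nonneg _)
      · rw [hinv, Complex.inv_im, h3, neg_zero, zero_div]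

/-- The segment from a point of the half-disc towards `1`. -/
def segmentToOne (c : ↥halfDisc) (t : I) : ↥halfDisc :=
  ⟨(1 - t : ℝ) • (c : ℂ) + (t : ℝ) • 1,
    convex_halfDisc c.2 one_mem_halfDisc (sub_nonneg.2 t.2.2) t.2.1 (sub_add_cancel _ _)⟩

theorem continuous_segmentToOne (c : ↥halfDisc) : Continuous (segmentToOne c) := by
  refine Continuous.subtype_mk ?_ _
  fun_prop

theorem segmentToOne_eq (c : ↥halfDisc) (t : I) :
    (segmentToOne c t : ℂ) = 1 + ((1 - t : ℝ) : ℂ) * ((c : ℂ) - 1) := by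
  simp only [segmentToOne, Complex.real_smul]
  push_cast; ring

theorem norm_segmentToOne_sub_one (c : ↥halfDisc) (t : I) :
    ‖(segmentToOne c t : ℂ) - 1‖ = (1 - t) * ‖(c : ℂ) - 1‖ := by
  rw [segmentToOne_eq, add_sub_cancel_left, norm_mul, Complex.norm_real, Real.norm_eq_abs,
    abs_of_nonneg (sub_nonneg.2 t.2.2)]

/-- The points at distance `ε` from `1` are in the boundary of the knot complement. -/
theorem spherePoint_mem_frontier (ha : a ≠ 0) (hb : b ≠ 0) (hε : 0 < ε) (c : ↥halfDisc)
    (hc : ‖(c : ℂ) - 1‖ = ε) (q : Centers a b) :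
    spherePoint (c, q) ∈ frontier (knotComplement a b ε) := by
  rw [frontier_eq_closure_inter_closure]
  constructor
  · refine subset_closure (mem_knotComplement.2 ?_)
    rw [norm_coord_spherePoint_sub_one ha hb]
    exact hc.ge
  · have h0 : (0 : I) ∈ closure (Ioi (0 : I)) := by
      rw [closure_Ioi' ⟨1, zero_lt_one⟩]
      exact mem_Ici.2 le_rfl
    have hcont : Continuous fun t : I => (spherePoint (segmentToOne c t, q) : S3) :=
      continuous_spherePoint.comp ((continuous_segmentToOne c).prodMk continuous_const)
    have hs : segmentToOne c 0 = c := by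
      refine Subtype.ext ?_
      rw [segmentToOne_eq]; simp
    -- Any positive step towards 1 enters the open tube, and the steps tend to the given point as `t
    -- → 0`.
    have := map_mem_closure hcont h0 (t := (knotComplement a b ε)ᶜ) fun t ht => by
      intro hM
      have h1 := mem_knotComplement.1 hM
      rw [norm_coord_spherePoint_sub_one ha hb, norm_segmentToOne_sub_one, hc] at h1
      have h2 : (0 : ℝ) < t := ht
      nlinarith
    simpa only [hs] using this

/-- The collapse of the knot complement onto its spine, with the boundary of the tube. -/
def spineCollapse (ha : a ≠ 0) (hb : b ≠ 0) (hε : 0 < ε) (hε1 : ε < 1) :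
    FiberwiseCollapse ↥(knotComplement a b ε) ↥(spine a b ε) where
  incl := ⟨fun y => ⟨y.1, y.2.1⟩, continuous_subtype_val.subtype_mk _⟩
  retr := ⟨collapse ha hb hε hε1, by
    refine Continuous.subtype_mk (Continuous.subtype_mk ?_ _) _
    have h := (continuous_complementFlow ha hb hε).comp
      (continuous_const.prodMk continuous_id : Continuous fun x => ((1 : I), x))
    refine (continuous_subtype_val.comp (continuous_subtype_val.comp h)).congr fun x => ?_
    exact (complementFlow_val ha hb hε 1 x).trans (flowFun_one x.1)⟩
  flow := ⟨complementFlow ha hb hε, continuous_complementFlow ha hb hε⟩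
  bd := {x | x.1 ∈ frontier (knotComplement a b ε)}
  retr_incl y := Subtype.ext (Subtype.ext (collapseFun_of_mem_spine hε y.2))
  flow_zero x := by
    obtain ⟨p, rfl⟩ := surjective_complementPoint ha hb x
    refine (complementFlow_complementPoint ha hb hε 0 p).trans ?_
    congr 2
    exact Subtype.ext (Subtype.ext (halfDiscRay_zero _))
  flow_one x := Subtype.ext (Subtype.ext
    ((complementFlow_val ha hb hε 1 x).trans (flowFun_one x.1)))
  retr_flow t x := by
    obtain ⟨p, rfl⟩ := surjective_complementPoint ha hb x
    refine Subtype.ext (Subtype.ext ?_)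
    change collapseFun a b (complementFlow ha hb hε (t, complementPoint ha hb p)) =
      collapseFun a b (complementPoint ha hb p)
    rw [complementFlow_complementPoint, ← flowFun_one, ← flowFun_one]
    have h := fun x => complementFlow_val ha hb hε 1 x
    simp only [Set.Icc.coe_one] at h
    rw [← h, ← h, complementFlow_complementPoint, complementFlow_complementPoint,
      truncatedRay_truncatedRay]
  exists_leg y := by
    obtain ⟨p, hp⟩ := surjective_complementPoint ha hb
      (⟨y.1, y.2.1⟩ : ↥(knotComplement a b ε))
    obtain ⟨c, q⟩ := p
    have hpos : 0 < ‖(c.1 : ℂ) - 1‖ := hε.trans_le c.2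
    have hle : ε / ‖(c.1 : ℂ) - 1‖ ≤ 1 := (div_le_one hpos).2 c.2
    have h0 : 0 < ε / ‖(c.1 : ℂ) - 1‖ := div_pos hε hpos
    -- The speed is chosen so that the segment towards 1 stops at distance exactly `ε`, on the
    -- boundary of the tube.
    let s : I → I := fun t => ⟨t * (1 - ε / ‖(c.1 : ℂ) - 1‖),
      mul_nonneg t.2.1 (by linarith), mul_le_one₀ t.2.2 (by linarith) (by linarith)⟩
    have hs : Continuous s := by
      refine Continuous.subtype_mk ?_ _
      fun_prop
    have hs1 : ∀ t, ε / ‖(c.1 : ℂ) - 1‖ ≤ 1 - s t := fun t => by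
      have : (s t : ℝ) ≤ 1 - ε / ‖(c.1 : ℂ) - 1‖ :=
        mul_le_of_le_one_left (by linarith) t.2.2
      linarith
    let d : I → TruncatedHalfDisc ε := fun t => ⟨segmentToOne c.1 (s t), by
      rw [norm_segmentToOne_sub_one, ← div_le_iff₀ hpos]
      exact hs1 t⟩
    have hd : Continuous d := ((continuous_segmentToOne c.1).comp hs).subtype_mk _
    refine ⟨⟨fun t => complementPoint ha hb (d t, q),
      (continuous_complementPoint ha hb).comp (hd.prodMk continuous_const)⟩, ?_, fun t => ?_, ?_⟩
    · refine Eq.trans ?_ hp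
      change complementPoint ha hb (d 0, q) = _
      congr 2
      refine Subtype.ext (Subtype.ext ?_)
      change (segmentToOne c.1 (s 0) : ℂ) = c.1
      rw [segmentToOne_eq]
      simp [s]
    · refine Subtype.ext (Subtype.ext ?_)
      change collapseFun a b (complementPoint ha hb (d t, q)) = y.1.1
      rw [← collapseFun_of_mem_spine hε y.2]
      change _ = collapseFun a b (⟨y.1, y.2.1⟩ : ↥(knotComplement a b ε))
      rw [← hp, ← flowFun_one, ← flowFun_one]
      have e1 := flowFun_spherePoint ha hb ((d t).1, q) ((d t).ne_one hε) 1
      have e2 := flowFun_spherePoint ha hb (c.1, q) (c.ne_one hε) 1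
      refine e1.trans (Eq.trans ?_ e2.symm)
      change sectorPoint a b (halfDiscRay 1 (segmentToOne c.1 (s t))) q =
        sectorPoint a b (halfDiscRay 1 c.1) q
      rw [halfDiscRay_one, halfDiscRay_one, segmentToOne_eq,
        halfDiscProj_one_add_mul (h0.trans_le (hs1 t))]
    · refine spherePoint_mem_frontier ha hb hε _ ?_ q
      change ‖(segmentToOne c.1 (s 1) : ℂ) - 1‖ = ε
      rw [norm_segmentToOne_sub_one]
      simp [s, div_mul_cancel₀ _ hpos.ne']

/-- The boundary of the thickened knot complement in terms of `FiberwiseCollapse`. -/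
def bdryHomeomorph (ha : a ≠ 0) (hb : b ≠ 0) (hε : 0 < ε) (hε1 : ε < 1) :
    ↥(bdry a b ε) ≃ₜ (spineCollapse ha hb hε hε1).Boundary where
  toFun q := ⟨(⟨q.1.1, q.2.1⟩, q.1.2), q.2.2⟩
  invFun q := ⟨(q.1.1.1, q.1.2), q.1.1.2, q.2⟩
  left_inv _ := rfl
  right_inv _ := rfl
  continuous_toFun := by
    refine Continuous.subtype_mk ?_ _
    exact ((continuous_fst.comp continuous_subtype_val).subtype_mk _).prodMk
      (continuous_snd.comp continuous_subtype_val)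
  continuous_invFun := by
    refine Continuous.subtype_mk ?_ _
    exact (continuous_subtype_val.comp (continuous_fst.comp continuous_subtype_val)).prodMk
      (continuous_snd.comp continuous_subtype_val)

end TorusKnotSpine

end

theorem lemma3p6 (a b : ℤ) (ha : a ≠ 0) (hb : b ≠ 0) (hab : IsCoprime a b)
    (ε : ℝ) (hε : 0 < ε) (hε1 : ε < 1) :
    TorusKnotSpine.IsUVOneMap.{u} (TorusKnotSpine.bdryCollapse ha hb hε hε1) :=
  (TorusKnotSpine.spineCollapse ha hb hε hε1).isUVOneMap_proj.comp_homeomorph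
    (TorusKnotSpine.bdryHomeomorph ha hb hε hε1)
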